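/- For every real number $\epsilon>0$ there is a constant $c<\infty$, depending only on $\epsilon$, such that for every integer $d\ge 1$, every finite field $F$ with $|F|\ge cd$, and every $m\ge 0$ the following holds. Let $f:F^m\to F$ be a function and let $\{P_{x,h}\}_{x,h\in F^m}$ be a family of univariate polynomials over $F$, each of degree at most $d$ (one for each pair $(x,h)$, describing the line $\{x+t\cdot h : t\in F\}$; no consistency between different pairs describing the same line is required). Let $$\delta=\Pr_{x,h,t}\left[P_{x,h}(t)\ne f(x+t\cdot h)\right],$$ where $x,h\in F^m$ and $t\in F$ are chosen independently and uniformly at random. If $\delta\le \frac18-\epsilon$, then there is a polynomial $g\in F[X_1,\dots,X_m]$ of total degree at most $d$ with $d(f,g)\le 2\delta$, where $d(f,g)=\Pr_{x\in F^m}[f(x)\ne g(x)]$ for $x$ uniform in $F^m$. -/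

import Mathlib

namespace LowDegreeTest

open Classical in
/-- The probability of the event `p` under the uniform distribution on the finite type `α`. -/
noncomputable def uniformProb {α : Type*} [Fintype α] (p : α → Prop) : ℝ :=
  ((Finset.univ.filter p).card : ℝ) / (Fintype.card α : ℝ)

/-- The distance `d(f, g) = Pr_{x ∈ F^m} [f x ≠ g x]` between two functions on `F^m`. -/
noncomputable def dist {F : Type*} [Fintype F] {m : ℕ} (f g : (Fin m → F) → F) : ℝ :=
  uniformProb (fun x : Fin m → F => f x ≠ g x)

/-- The rejection probability `Pr_{x,h,t} [P_{x,h}(t) ≠ f(x + t h)]` of the lines test, for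
`x, h ∈ F^m` and `t ∈ F` uniform and independent. -/
noncomputable def rejectProb {F : Type*} [Field F] [Fintype F] {m : ℕ}
    (f : (Fin m → F) → F) (P : (Fin m → F) → (Fin m → F) → Polynomial F) : ℝ :=
  uniformProb (fun w : (Fin m → F) × (Fin m → F) × F =>
    (P w.1 w.2.1).eval w.2.2 ≠ f (w.1 + w.2.2 • w.2.1))

end LowDegreeTest

/-!
Consider grids of points parametrised by `F × F` whose rows and columns are lines. The line
polynomials give a polynomial on each row and on each column of such a grid. The theorem rests on
the bivariate statement of Polishchuk and Spielman (`exists_bivariate_of_card_lt`,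
`exists_grid_function`): if rows and columns of degree at most `d` disagree on slightly less than
a quarter of the grid, then all but a quarter of the rows and of the columns come from one
function `Q` of bidegree at most `(d, d)`. For its proof, choose a nonzero `E` of small bidegree
vanishing at the disagreements, interpolate `P` from the products of `E` with the rows and
columns, and show that `E` divides `P` (`dvd_of_dvd_on_lines`); after cancelling the greatest
common divisor, this is a count of the zeros of the Sylvester determinant with multiplicities
(`card_mul_natDegree_le`).

The line polynomials are replaced by a best fitting table `W`, where `W h x` is the value at `x`
predicted by the line through `x` in the direction `h`. If the table errs on a fraction below one
eighth of the points, then rows and columns of a random grid disagree on less than a quarter of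
it; moreover a row whose values are predicted well by the columns must itself come from `Q`, since
it is a best fit and the field is large. Hence at a given point of the grid the predictions of a
row and of a column agree (`grid_row_eq_col`).

This is used twice.

* For a small absolute error (`IsOptimalTable.exists_lowDegree_of_small`), expectations and
  Markov's inequality suffice to treat every point: two random lines through a fixed point almost
  always predict the same value there, and the common prediction `g` has degree at most `d` on
  every line. Where `f` and `g` differ, at least half of the lines are wrong about `f`, which
  gives the distance `2 δ`.
* For an error below `1 / 8` (`IsOptimalTable.exists_tableError_le`), the errors of the rows of a
  random bilinear grid through a random point are pairwise independent, so they concentrate by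
  Chebyshev's inequality. The table is then correct up to a tiny error `γ` for some function `g`,
  and the first case applies to `g`. The resulting distance `δ + 3 γ` is at most `2 δ` unless `δ`
  is so small that the first case applies to `f` itself.

A function of degree at most `d` on every line is a polynomial of total degree at most `d`,
because `|F| > 2 d` (`exists_mvPolynomial_of_forall_line`).
-/

namespace LowDegreeTest

/-! ### Divisibility on lines and the Sylvester determinant -/

section

open Polynomial Polynomial.Bivariate

variable {F : Type*} [Field F]

theorem coeff_coeff_swap (p : F[X][Y]) (i j : ℕ) :
    ((swap p).coeff i).coeff j = (p.coeff j).coeff i := by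
  induction p using Polynomial.induction_on' with
  | add p q hp hq => simp [hp, hq]
  | monomial n f =>
    induction f using Polynomial.induction_on' with
    | add p q hp hq => simp only [map_add, coeff_add, hp, hq]
    | monomial m r =>
      rw [swap_monomial_monomial]
      simp only [coeff_monomial]
      split_ifs <;> simp_all [coeff_monomial]

theorem natDegree_coeff_le_natDegree_swap (p : F[X][Y]) (k : ℕ) :
    (p.coeff k).natDegree ≤ (swap p).natDegree := by
  rw [natDegree_le_iff_coeff_eq_zero]
  intro N hN
  rw [← coeff_coeff_swap, coeff_eq_zero_of_natDegree_lt hN, coeff_zero]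

theorem natDegree_det_le {ι R : Type*} [Fintype ι] [DecidableEq ι] [CommRing R]
    (M : Matrix ι ι R[X]) (β : ι → ℕ) (h : ∀ r c, (M r c).natDegree ≤ β r) :
    M.det.natDegree ≤ ∑ r, β r := by
  -- Transposing makes every product in the expansion run over the rows.
  rw [← Matrix.det_transpose, Matrix.det_apply]
  refine natDegree_sum_le_of_forall_le _ _ fun σ _ => ?_
  refine (natDegree_smul_le _ _).trans ?_
  refine (natDegree_prod_le _ _).trans ?_
  exact Finset.sum_le_sum fun r _ => h r _

theorem pow_card_dvd_det {ι κ R : Type*} [Fintype ι] [DecidableEq ι] [Fintype κ] [DecidableEq κ]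
    [CommRing R] (M : Matrix (ι ⊕ κ) (ι ⊕ κ) R) (q : R) (h : ∀ k c, q ∣ M (Sum.inl k) c) :
    q ^ Fintype.card ι ∣ M.det := by
  choose N hN using h
  have hM : M = Matrix.diagonal (Sum.elim (fun _ => q) (fun _ => 1)) *
      Matrix.of (Sum.elim N (fun k c => M (Sum.inr k) c)) := by
    ext r c
    rcases r with k | k <;> simp [hN]
  rw [hM, Matrix.det_mul, Matrix.det_diagonal, Fintype.prod_sum_type]
  simp

/-- The Sylvester rows `Y ^ k * P` for `k < a` and `Y ^ k * E` for `k < c`. -/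
noncomputable def sylvesterRow (P E : F[X][Y]) (a c : ℕ) : Fin a ⊕ Fin c → F[X][Y] :=
  Sum.elim (fun k => X ^ (k : ℕ) * P) (fun k => X ^ (k : ℕ) * E)

/-- The Sylvester matrix of `P` and `E`, as polynomials in `Y` over `F[X]` of formal degrees `c`
and `a`. -/
noncomputable def sylvesterMatrix (P E : F[X][Y]) (a c : ℕ) :
    Matrix (Fin a ⊕ Fin c) (Fin a ⊕ Fin c) F[X] :=
  Matrix.of fun r s => (sylvesterRow P E a c r).coeff (finSumFinEquiv s : Fin (a + c))

theorem sum_C_mul_X_pow_natDegree_lt {R : Type*} [CommRing R] {a : ℕ} (v : Fin a → R)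
    (h : (∑ k, C (v k) * X ^ (k : ℕ) : R[X]) ≠ 0) :
    (∑ k, C (v k) * X ^ (k : ℕ) : R[X]).natDegree < a := by
  rw [natDegree_lt_iff_degree_lt h, degree_lt_iff_coeff_zero]
  intro m hm
  rw [finsetSum_coeff]
  refine Finset.sum_eq_zero fun k _ => ?_
  rw [coeff_C_mul, coeff_X_pow, if_neg (by omega), mul_zero]

theorem sum_C_mul_X_pow_eq_zero {R : Type*} [CommRing R] {a : ℕ} (v : Fin a → R)
    (h : (∑ k, C (v k) * X ^ (k : ℕ) : R[X]) = 0) (k : Fin a) : v k = 0 := by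
  have := congrArg (fun p => p.coeff k) h
  simp only [finsetSum_coeff, coeff_C_mul, coeff_X_pow, coeff_zero] at this
  rw [Finset.sum_eq_single k] at this
  · simpa using this
  · intro l _ hl
    rw [if_neg (fun h => hl (Fin.ext h.symm)), mul_zero]
  · simp

/-- A vector in the kernel would give `U * P + V * E = 0` with `deg_Y U < deg_Y E`, against
coprimality. -/
theorem det_sylvesterMatrix_ne_zero (P E : F[X][Y]) (d : ℕ) (hE : E ≠ 0) (hrel : IsRelPrime E P)
    (hP : P.natDegree ≤ E.natDegree + d) :
    (sylvesterMatrix P E E.natDegree (E.natDegree + d)).det ≠ 0 := by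
  intro hdet
  set a := E.natDegree with ha
  obtain ⟨v, hv, hvM⟩ := Matrix.exists_vecMul_eq_zero_iff.mpr hdet
  set U : F[X][Y] := ∑ k, C (v (Sum.inl k)) * X ^ (k : ℕ) with hU
  set V : F[X][Y] := ∑ k, C (v (Sum.inr k)) * X ^ (k : ℕ) with hV
  have hcomb : U * P + V * E = ∑ r, C (v r) * sylvesterRow P E a (a + d) r := by
    rw [Fintype.sum_sum_type, hU, hV, Finset.sum_mul, Finset.sum_mul]
    simp [sylvesterRow, mul_assoc]
  have hzero : U * P + V * E = 0 := by
    ext1 m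
    rw [coeff_zero]
    by_cases hm : m < a + (a + d)
    · have := congrFun hvM (finSumFinEquiv.symm ⟨m, hm⟩)
      rw [Matrix.vecMul, dotProduct] at this
      simp only [sylvesterMatrix, Matrix.of_apply, Equiv.apply_symm_apply, Pi.zero_apply] at this
      rw [hcomb, finsetSum_coeff]
      simpa only [coeff_C_mul] using this
    · rw [hcomb, finsetSum_coeff]
      refine Finset.sum_eq_zero fun r _ => ?_
      rw [coeff_C_mul, coeff_eq_zero_of_natDegree_lt, mul_zero]
      push Not at hm
      refine lt_of_lt_of_le ?_ hm
      rcases r with k | k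
      · have := k.2
        refine (natDegree_mul_le (p := X ^ (k : ℕ)) (q := P)).trans_lt ?_
        rw [natDegree_X_pow]; omega
      · have := k.2
        refine (natDegree_mul_le (p := X ^ (k : ℕ)) (q := E)).trans_lt ?_
        rw [natDegree_X_pow]; omega
  have hdvd : E ∣ U := hrel.dvd_of_dvd_mul_right
    ⟨-V, by linear_combination hzero⟩
  have hU0 : U = 0 := by
    by_contra hne
    have := natDegree_le_of_dvd hdvd hne
    have : U.natDegree < a := sum_C_mul_X_pow_natDegree_lt _ hne
    omega
  have hV0 : V = 0 := by
    rw [hU0, zero_mul, zero_add] at hzero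
    exact (mul_eq_zero.mp hzero).resolve_right hE
  apply hv
  ext1 r
  rcases r with k | k
  · exact sum_C_mul_X_pow_eq_zero _ hU0 k
  · exact sum_C_mul_X_pow_eq_zero _ hV0 k

/-- Row operations with coefficients in `F` make the first `a` rows of the Sylvester matrix
divisible by `X - x` as soon as `E(x, Y)` divides `P(x, Y)`. -/
theorem pow_dvd_det_sylvesterMatrix (P E : F[X][Y]) (a d : ℕ) (x : F) (R : F[X])
    (hR : R.natDegree ≤ d)
    (h : P.map (evalRingHom x) = R * E.map (evalRingHom x)) :
    (X - C x) ^ a ∣ (sylvesterMatrix P E a (a + d)).det := by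
  set M := sylvesterMatrix P E a (a + d) with hM
  set A : Matrix (Fin a) (Fin (a + d)) F[X] :=
    Matrix.of fun k l => C ((X ^ (k : ℕ) * R).coeff l) with hA
  have hdet : M.det = (Matrix.fromBlocks 1 (-A) 0 1 * M).det := by
    rw [Matrix.det_mul, Matrix.det_fromBlocks_zero₂₁]; simp
  rw [hdet]
  have := pow_card_dvd_det (Matrix.fromBlocks 1 (-A) 0 1 * M) (X - C x) ?_
  · simpa using this
  intro k c
  rw [dvd_iff_isRoot, IsRoot.def, Matrix.mul_apply, Fintype.sum_sum_type, eval_add,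
    eval_finsetSum, eval_finsetSum]
  rw [Finset.sum_eq_single k (by
    intro b _ hb
    simp [Matrix.one_apply_ne hb.symm]) (by simp)]
  set m : ℕ := ((finSumFinEquiv c : Fin (a + (a + d))) : ℕ) with hm
  have e1 : eval x (M (Sum.inl k) c) = (X ^ (k : ℕ) * P.map (evalRingHom x)).coeff m := by
    rw [← Polynomial.map_X (evalRingHom x), ← Polynomial.map_pow, ← Polynomial.map_mul, coeff_map]
    rfl
  have e2 : ∀ l, eval x (M (Sum.inr l) c) = (X ^ (l : ℕ) * E.map (evalRingHom x)).coeff m := by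
    intro l
    rw [← Polynomial.map_X (evalRingHom x), ← Polynomial.map_pow, ← Polynomial.map_mul, coeff_map]
    rfl
  have hdeg : (X ^ (k : ℕ) * R).natDegree < a + d := by
    refine (natDegree_mul_le).trans_lt ?_
    rw [natDegree_X_pow]
    have := k.2
    omega
  have e3 : (X ^ (k : ℕ) * P.map (evalRingHom x)) =
      ∑ l : Fin (a + d), C ((X ^ (k : ℕ) * R).coeff l) * (X ^ (l : ℕ) * E.map (evalRingHom x)) := by
    rw [h, ← mul_assoc]
    conv_lhs => rw [Polynomial.as_sum_range_C_mul_X_pow' _ hdeg]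
    rw [Finset.sum_range, Finset.sum_mul]
    simp only [mul_assoc]
  simp only [Matrix.fromBlocks_apply₁₁, Matrix.fromBlocks_apply₁₂, Matrix.one_apply_eq, one_mul,
    Matrix.neg_apply, neg_mul, eval_neg, eval_mul, e1, e2, hA, Matrix.of_apply, eval_C]
  rw [e3, finsetSum_coeff]
  simp only [coeff_C_mul, Finset.sum_neg_distrib, add_neg_cancel]

/-- A Bezout-type bound on the number of vertical lines on which `E` divides `P`: each of them
is a root of the resultant of multiplicity `deg_Y E`. -/
theorem card_mul_natDegree_le (P E : F[X][Y]) (b d : ℕ) (I : Finset F) (hE : E ≠ 0)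
    (hrel : IsRelPrime E P) (hP : P.natDegree ≤ E.natDegree + d)
    (hEb : (swap E).natDegree ≤ b) (hPb : (swap P).natDegree ≤ b + d)
    (hI : ∀ x ∈ I, ∃ R : F[X], R.natDegree ≤ d ∧
      P.map (evalRingHom x) = R * E.map (evalRingHom x)) :
    I.card * E.natDegree ≤ E.natDegree * (b + d) + (E.natDegree + d) * b := by
  set a := E.natDegree with ha
  set D := (sylvesterMatrix P E a (a + d)).det with hD
  have hD0 : D ≠ 0 := det_sylvesterMatrix_ne_zero P E d hE hrel hP
  have hdeg : D.natDegree ≤ a * (b + d) + (a + d) * b := by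
    refine (natDegree_det_le _ (Sum.elim (fun _ => b + d) (fun _ => b)) ?_).trans ?_
    · intro r c
      rcases r with k | k
      · simp only [sylvesterMatrix, sylvesterRow, Matrix.of_apply, Sum.elim_inl, coeff_X_pow_mul']
        split_ifs
        · exact (natDegree_coeff_le_natDegree_swap _ _).trans hPb
        · simp
      · simp only [sylvesterMatrix, sylvesterRow, Matrix.of_apply, Sum.elim_inr, coeff_X_pow_mul']
        split_ifs
        · exact (natDegree_coeff_le_natDegree_swap _ _).trans hEb
        · simp
    · rw [Fintype.sum_sum_type]; simp
  have hdvd : ∏ x ∈ I, (X - C x) ^ a ∣ D := by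
    refine Finset.prod_dvd_of_coprime ?_ ?_
    · intro x _ y _ hxy
      exact (isCoprime_X_sub_C_of_isUnit_sub (sub_ne_zero.mpr hxy).isUnit).pow
    · intro x hx
      obtain ⟨R, hR, h⟩ := hI x hx
      exact pow_dvd_det_sylvesterMatrix P E a d x R hR h
  have := natDegree_le_of_dvd hdvd hD0
  rw [natDegree_prod_of_monic _ _ (fun x _ => (monic_X_sub_C x).pow a)] at this
  simp only [natDegree_pow, natDegree_X_sub_C, mul_one, Finset.sum_const, smul_eq_mul] at this
  omega

end

/-! ### The bivariate theorem of Polishchuk and Spielman -/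

section

open Polynomial Polynomial.Bivariate

variable {F : Type*} [Field F]

theorem eval_map_evalRingHom_swap (E : F[X][Y]) (x y : F) :
    ((swap E).map (evalRingHom y)).eval x = (E.map (evalRingHom x)).eval y := by
  induction E using Polynomial.induction_on' with
  | add p q hp hq => simp only [map_add, Polynomial.map_add, eval_add, hp, hq]
  | monomial n f =>
    induction f using Polynomial.induction_on' with
    | add p q hp hq => simp only [map_add, Polynomial.map_add, eval_add, hp, hq]
    | monomial m r =>
      rw [swap_monomial_monomial]
      simp only [map_monomial, coe_evalRingHom, eval_monomial]
      ring

/-- Fewer than `(e + 1) ^ 2` points are the zeros of a nonzero polynomial of bidegree at most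
`(e, e)`. -/
theorem exists_bivariate_vanishing (S : Finset (F × F)) (e : ℕ) (hS : S.card < (e + 1) ^ 2) :
    ∃ E : F[X][Y], E ≠ 0 ∧ E.natDegree ≤ e ∧ (swap E).natDegree ≤ e ∧
      ∀ s ∈ S, (E.map (evalRingHom s.1)).eval s.2 = 0 := by
  let L : (Fin (e + 1) × Fin (e + 1) → F) →ₗ[F] (S → F) :=
    { toFun := fun v s => ∑ k, v k * (s.1.1 ^ (k.2 : ℕ) * s.1.2 ^ (k.1 : ℕ))
      map_add' := fun v w => by ext s; simp [add_mul, Finset.sum_add_distrib]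
      map_smul' := fun r v => by ext s; simp [Finset.mul_sum, mul_assoc] }
  have hL : LinearMap.ker L ≠ ⊥ := L.ker_ne_bot_of_finrank_lt (by
    rw [Module.finrank_fintype_fun_eq_card, Module.finrank_fintype_fun_eq_card]
    simpa [sq] using hS)
  obtain ⟨v, hv, hv0⟩ := (Submodule.ne_bot_iff _).mp hL
  set E : F[X][Y] := ∑ k : Fin (e + 1) × Fin (e + 1),
    monomial (k.1 : ℕ) (monomial (k.2 : ℕ) (v k)) with hE
  refine ⟨E, ?_, ?_, ?_, ?_⟩
  · intro h0
    apply hv0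
    ext1 k
    have := congrArg (fun p => (p.coeff (k.1 : ℕ)).coeff (k.2 : ℕ)) h0
    simp only [hE, finsetSum_coeff, coeff_monomial, coeff_zero] at this
    rw [Finset.sum_eq_single k] at this
    · simpa using this
    · intro l _ hl
      split_ifs with h1
      · rw [coeff_monomial, if_neg]
        exact fun h2 => hl (Prod.ext (Fin.ext h1) (Fin.ext h2))
      · simp
    · simp
  · refine natDegree_sum_le_of_forall_le _ _ fun k _ => ?_
    exact (natDegree_monomial_le _).trans (Nat.lt_succ_iff.mp k.1.2)
  · rw [hE, map_sum]
    refine natDegree_sum_le_of_forall_le _ _ fun k _ => ?_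
    rw [swap_monomial_monomial]
    exact (natDegree_monomial_le _).trans (Nat.lt_succ_iff.mp k.2.2)
  · intro s hs
    have := congrFun (LinearMap.mem_ker.mp hv) ⟨s, hs⟩
    simp only [L, LinearMap.coe_mk, AddHom.coe_mk, Pi.zero_apply] at this
    rw [hE, Polynomial.map_sum, eval_finsetSum, ← this]
    refine Finset.sum_congr rfl fun k _ => ?_
    simp only [map_monomial, coe_evalRingHom, eval_monomial]
    ring

variable [Fintype F]

theorem eq_of_natDegree_lt_card {p q : F[X]} (h : ∀ x, p.eval x = q.eval x)
    (hp : p.natDegree < Fintype.card F) (hq : q.natDegree < Fintype.card F) : p = q :=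
  eq_of_natDegree_lt_card_of_eval_eq p q Function.injective_id h (max_lt hp hq)

open Classical in
theorem card_filter_map_eq_zero_le (G : F[X][Y]) (hG : G ≠ 0) :
    (Finset.univ.filter fun x : F => G.map (evalRingHom x) = 0).card ≤ (swap G).natDegree := by
  have hl : G.leadingCoeff ≠ 0 := leadingCoeff_ne_zero.mpr hG
  refine le_trans ?_ ((card_roots' G.leadingCoeff).trans (natDegree_coeff_le_natDegree_swap G _))
  refine le_trans (Finset.card_le_card ?_) (Multiset.toFinset_card_le _)
  intro x hx
  rw [Multiset.mem_toFinset, mem_roots hl, IsRoot.def]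
  have := congrArg (fun p => p.coeff G.natDegree) (Finset.mem_filter.mp hx).2
  simpa using this

open Classical in
theorem card_le_card_filter_map_ne_zero (G : F[X][Y]) (hG : G ≠ 0) :
    Fintype.card F ≤ (Finset.univ.filter fun x : F => G.map (evalRingHom x) ≠ 0).card +
      (swap G).natDegree := by
  have h1 := card_filter_map_eq_zero_le G hG
  have h2 := Finset.card_filter_add_card_filter_not (s := (Finset.univ : Finset F))
    (fun x : F => G.map (evalRingHom x) = 0)
  rw [Finset.card_univ] at h2
  simp only [ne_eq]
  omega

/-- The divisibility criterion of Polishchuk and Spielman: if `E` divides `P` on every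
axis-parallel line, with quotients of degree at most `d`, and the field is large compared with
the degrees, then `E` divides `P`. After removing the greatest common divisor, the Bezout-type
bound is applied in the direction in which `E` has the larger degree. -/
theorem dvd_of_dvd_on_lines (E P : F[X][Y]) (e d : ℕ) (hE : E ≠ 0)
    (hEY : E.natDegree ≤ e) (hEX : (swap E).natDegree ≤ e)
    (hPY : P.natDegree ≤ E.natDegree + d) (hPX : (swap P).natDegree ≤ (swap E).natDegree + d)
    (hn : 2 * e + 2 * d < Fintype.card F)
    (hrow : ∀ x, ∃ R : F[X], R.natDegree ≤ d ∧
      P.map (evalRingHom x) = R * E.map (evalRingHom x))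
    (hcol : ∀ y, ∃ R : F[X], R.natDegree ≤ d ∧
      (swap P).map (evalRingHom y) = R * (swap E).map (evalRingHom y)) :
    E ∣ P := by
  classical
  by_cases hP : P = 0
  · rw [hP]; exact dvd_zero E
  obtain ⟨E', P', G, hrel, hGE, hGP⟩ := UniqueFactorizationMonoid.exists_reduced_factors E hE P
  have hG0 : G ≠ 0 := by rintro rfl; exact hE (by rw [← hGE, zero_mul])
  have hE0 : E' ≠ 0 := by rintro rfl; exact hE (by rw [← hGE, mul_zero])
  have hP0 : P' ≠ 0 := by rintro rfl; exact hP (by rw [← hGP, mul_zero])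
  have sne : ∀ {p : F[X][Y]}, p ≠ 0 → swap p ≠ 0 := fun h =>
    (map_ne_zero_iff _ (swap (R := F)).injective).mpr h
  have e1 : E.natDegree = G.natDegree + E'.natDegree := by rw [← hGE, natDegree_mul hG0 hE0]
  have e2 : P.natDegree = G.natDegree + P'.natDegree := by rw [← hGP, natDegree_mul hG0 hP0]
  have e3 : (swap E).natDegree = (swap G).natDegree + (swap E').natDegree := by
    rw [← hGE, map_mul, natDegree_mul (sne hG0) (sne hE0)]
  have e4 : (swap P).natDegree = (swap G).natDegree + (swap P').natDegree := by
    rw [← hGP, map_mul, natDegree_mul (sne hG0) (sne hP0)]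
  have hrel' : IsRelPrime (swap E') (swap P') := by
    intro c hc1 hc2
    have h1 := map_dvd (swap (R := F)) hc1
    have h2 := map_dvd (swap (R := F)) hc2
    rw [swap_swap_apply] at h1 h2
    have hu := (hrel h1 h2).map (swap (R := F))
    rwa [swap_swap_apply] at hu
  -- Cancelling `G` keeps the hypothesis on every line on which `G` does not vanish.
  have key1 := card_mul_natDegree_le P' E' (swap E').natDegree d
    (Finset.univ.filter fun x : F => G.map (evalRingHom x) ≠ 0) hE0 hrel (by omega) le_rfl
    (by omega) (by
      intro x hx
      obtain ⟨R, hR, h⟩ := hrow x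
      refine ⟨R, hR, mul_left_cancel₀ (Finset.mem_filter.mp hx).2 ?_⟩
      rw [← hGE, ← hGP, Polynomial.map_mul, Polynomial.map_mul] at h
      rw [h]; ring)
  have key2 := card_mul_natDegree_le (swap P') (swap E') E'.natDegree d
    (Finset.univ.filter fun x : F => (swap G).map (evalRingHom x) ≠ 0) (sne hE0) hrel' (by omega)
    (by rw [swap_swap_apply]) (by rw [swap_swap_apply]; omega) (by
      intro x hx
      obtain ⟨R, hR, h⟩ := hcol x
      refine ⟨R, hR, mul_left_cancel₀ (Finset.mem_filter.mp hx).2 ?_⟩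
      rw [← hGE, ← hGP, map_mul, map_mul, Polynomial.map_mul, Polynomial.map_mul] at h
      rw [h]; ring)
  have c1 := card_le_card_filter_map_ne_zero G hG0
  have c2 := card_le_card_filter_map_ne_zero (swap G) (sne hG0)
  rw [swap_swap_apply] at c2
  set a := E'.natDegree
  set b := (swap E').natDegree
  have hab : a = 0 ∧ b = 0 := by
    rcases le_total b a with hle | hle
    · rcases Nat.eq_zero_or_pos a with ha | ha
      · exact ⟨ha, by omega⟩
      · exfalso
        have h1 : (2 * b + 2 * d + 1) * a ≤ a * (b + d) + (a + d) * b :=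
          (Nat.mul_le_mul_right a (by omega)).trans key1
        nlinarith
    · rcases Nat.eq_zero_or_pos b with hb | hb
      · exact ⟨by omega, hb⟩
      · exfalso
        have h1 : (2 * a + 2 * d + 1) * b ≤ b * (a + d) + (b + d) * a :=
          (Nat.mul_le_mul_right b (by omega)).trans key2
        nlinarith
  have hu : IsUnit E' := by
    obtain ⟨p, hp⟩ := natDegree_eq_zero.mp hab.1
    have hpd : p.natDegree = 0 := by
      have := natDegree_coeff_le_natDegree_swap E' 0
      rw [← hp, coeff_C_zero, hp] at this
      exact Nat.le_zero.mp (this.trans hab.2.le)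
    obtain ⟨r, hr⟩ := natDegree_eq_zero.mp hpd
    have hr0 : r ≠ 0 := by
      rintro rfl
      apply hE0
      rw [← hp, ← hr, C_0, C_0]
    rw [← hp, ← hr]
    exact ((isUnit_iff_ne_zero.mpr hr0).map C).map C
  rw [← hGE, ← hGP]
  exact mul_dvd_mul_left G (hu.dvd)

/-- A polynomial `P` of small bidegree interpolating the common values of `R x * E` and
`C y * E` on the grid. -/
theorem exists_bivariate_interpolation (E : F[X][Y]) (R C : F → F[X]) (d : ℕ)
    (hR : ∀ x, (R x).natDegree ≤ d) (hC : ∀ y, (C y).natDegree ≤ d)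
    (ha : E.natDegree + d < Fintype.card F) (hb : (swap E).natDegree + d < Fintype.card F)
    (h : ∀ x y, (R x).eval y * (E.map (evalRingHom x)).eval y =
      (C y).eval x * (E.map (evalRingHom x)).eval y) :
    ∃ P : F[X][Y], P.natDegree ≤ E.natDegree + d ∧ (swap P).natDegree ≤ (swap E).natDegree + d ∧
      (∀ x, P.map (evalRingHom x) = R x * E.map (evalRingHom x)) ∧
      ∀ y, (swap P).map (evalRingHom y) = C y * (swap E).map (evalRingHom y) := by
  classical
  obtain ⟨I, -, hI⟩ := Finset.exists_subset_card_eq (s := (Finset.univ : Finset F))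
    (n := (swap E).natDegree + d + 1) (by rw [Finset.card_univ]; omega)
  have hinj : Set.InjOn (id : F → F) (I : Set F) := Function.injective_id.injOn
  set T : F → F[X] := fun x => R x * E.map (evalRingHom x) with hT
  have hTdeg : ∀ x, (T x).natDegree ≤ E.natDegree + d := fun x => by
    refine natDegree_mul_le.trans ?_
    have := hR x
    have : (E.map (evalRingHom x)).natDegree ≤ E.natDegree := natDegree_map_le
    omega
  set P : F[X][Y] := ∑ x ∈ I, Polynomial.C (Lagrange.basis I id x) * (T x).map Polynomial.C
    with hP
  have hPY : P.natDegree ≤ E.natDegree + d := by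
    refine natDegree_sum_le_of_forall_le _ _ fun x _ => ?_
    exact (natDegree_C_mul_le _ _).trans (natDegree_map_le.trans (hTdeg x))
  have hswap : swap P = ∑ x ∈ I, (Lagrange.basis I id x).map Polynomial.C *
      Polynomial.C (T x) := by
    rw [hP, map_sum]
    refine Finset.sum_congr rfl fun x _ => ?_
    rw [map_mul, swap_C, swap_map_C]
  have hPX : (swap P).natDegree ≤ (swap E).natDegree + d := by
    rw [hswap]
    refine natDegree_sum_le_of_forall_le _ _ fun x hx => ?_
    refine (natDegree_mul_C_le _ _).trans (natDegree_map_le.trans ?_)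
    rw [Lagrange.natDegree_basis hinj hx]
    omega
  have hcol : ∀ y, (swap P).map (evalRingHom y) = C y * (swap E).map (evalRingHom y) := by
    intro y
    have hdeg : (C y * (swap E).map (evalRingHom y)).natDegree ≤ (swap E).natDegree + d := by
      refine natDegree_mul_le.trans ?_
      have := hC y
      have : ((swap E).map (evalRingHom y)).natDegree ≤ (swap E).natDegree := natDegree_map_le
      omega
    rw [Lagrange.eq_interpolate_of_eval_eq (f := C y * (swap E).map (evalRingHom y))
      (s := I) (v := id) (fun x => (T x).eval y) hinj ?_ ?_,
      Lagrange.interpolate_apply, hswap, Polynomial.map_sum]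
    · refine Finset.sum_congr rfl fun x _ => ?_
      have hid : (evalRingHom y).comp Polynomial.C = RingHom.id F := by ext; simp
      rw [Polynomial.map_mul, Polynomial.map_map, map_C, coe_evalRingHom, mul_comm, hid,
        Polynomial.map_id]
    · refine lt_of_le_of_lt degree_le_natDegree ?_
      rw [hI]
      exact_mod_cast Nat.lt_succ_of_le hdeg
    · intro x _
      simp only [id, hT, eval_mul]
      rw [h, eval_map_evalRingHom_swap]
  refine ⟨P, hPY, hPX, fun x => ?_, hcol⟩
  refine eq_of_natDegree_lt_card (fun y => ?_) ((natDegree_map_le.trans hPY).trans_lt ha)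
    ((hTdeg x).trans_lt ha)
  rw [← eval_map_evalRingHom_swap, hcol, eval_mul, eval_map_evalRingHom_swap, eval_mul, h]

open Classical in
/-- The Polishchuk–Spielman theorem: row polynomials and column polynomials of degree at most
`d` that disagree at fewer than `(e + 1) ^ 2` points of the grid come from one bivariate
polynomial, up to `e` rows and `e` columns. -/
theorem exists_bivariate_of_card_lt (R C : F → F[X]) (d e : ℕ)
    (hR : ∀ x, (R x).natDegree ≤ d) (hC : ∀ y, (C y).natDegree ≤ d)
    (hS : (Finset.univ.filter fun s : F × F => (R s.1).eval s.2 ≠ (C s.2).eval s.1).card <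
      (e + 1) ^ 2)
    (hn : 2 * e + 2 * d < Fintype.card F) :
    ∃ Q : F[X][Y], Q.natDegree ≤ d ∧ (swap Q).natDegree ≤ d ∧
      (Finset.univ.filter fun x : F => Q.map (evalRingHom x) ≠ R x).card ≤ e ∧
      (Finset.univ.filter fun y : F => (swap Q).map (evalRingHom y) ≠ C y).card ≤ e := by
  obtain ⟨E, hE, hEY, hEX, hvan⟩ := exists_bivariate_vanishing _ e hS
  obtain ⟨P, hPY, hPX, hrow, hcol⟩ := exists_bivariate_interpolation E R C d hR hC
    (by omega) (by omega) (fun x y => by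
      by_cases hxy : (R x).eval y = (C y).eval x
      · rw [hxy]
      · rw [hvan (x, y) (by simpa using hxy), mul_zero, mul_zero])
  obtain ⟨Q, rfl⟩ := dvd_of_dvd_on_lines E P e d hE hEY hEX hPY hPX hn
    (fun x => ⟨R x, hR x, hrow x⟩) (fun y => ⟨C y, hC y, hcol y⟩)
  have sE : swap E ≠ 0 := (map_ne_zero_iff _ (swap (R := F)).injective).mpr hE
  refine ⟨Q, ?_, ?_, ?_, ?_⟩
  · rcases eq_or_ne Q 0 with rfl | hQ
    · simp
    · rw [natDegree_mul hE hQ] at hPY; omega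
  · rcases eq_or_ne Q 0 with rfl | hQ
    · simp
    · have sQ : swap Q ≠ 0 := (map_ne_zero_iff _ (swap (R := F)).injective).mpr hQ
      rw [map_mul, natDegree_mul sE sQ] at hPX; omega
  · refine (Finset.card_le_card ?_).trans ((card_filter_map_eq_zero_le E hE).trans hEX)
    intro x hx
    simp only [Finset.mem_filter, Finset.mem_univ, true_and] at hx ⊢
    by_contra h0
    refine hx (mul_left_cancel₀ h0 ?_)
    rw [← Polynomial.map_mul, hrow, mul_comm]
  · refine (Finset.card_le_card ?_).trans ((card_filter_map_eq_zero_le (swap E) sE).trans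
      (by rwa [swap_swap_apply]))
    intro y hy
    simp only [Finset.mem_filter, Finset.mem_univ, true_and] at hy ⊢
    by_contra h0
    refine hy (mul_left_cancel₀ h0 ?_)
    rw [← Polynomial.map_mul, ← map_mul, hcol, mul_comm]

end

/-! ### Rows and columns of a grid -/

section

open Polynomial Polynomial.Bivariate

variable {F : Type*} [Field F]

/-- The function `u` on the line `F` is given by a polynomial of degree at most `d`. -/
def IsLowDegree (d : ℕ) (u : F → F) : Prop :=
  ∃ p : F[X], p.natDegree ≤ d ∧ ∀ t, u t = p.eval t

open Classical in
/-- `u` is a closest function of degree at most `d` to the function `φ` on the line `F`. -/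
def IsBestFit [Fintype F] (d : ℕ) (u φ : F → F) : Prop :=
  IsLowDegree d u ∧ ∀ v, IsLowDegree d v → hammingDist u φ ≤ hammingDist v φ

theorem IsLowDegree.comp_affine {d : ℕ} {u : F → F} (hu : IsLowDegree d u) (a b : F) :
    IsLowDegree d fun t => u (a * t + b) := by
  obtain ⟨p, hp, h⟩ := hu
  refine ⟨p.comp (C a * X + C b), ?_, fun t => ?_⟩
  · refine natDegree_comp_le.trans ((Nat.mul_le_mul hp natDegree_linear_le).trans ?_)
    omega
  · simp [h]

variable [Fintype F]

open Classical in
theorem IsLowDegree.eq_of_hammingDist_lt {d : ℕ} {u v : F → F} (hu : IsLowDegree d u)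
    (hv : IsLowDegree d v) (h : hammingDist u v + d < Fintype.card F) : u = v := by
  obtain ⟨p, hp, hup⟩ := hu
  obtain ⟨q, hq, hvq⟩ := hv
  by_contra hne
  have hpq : p - q ≠ 0 := by
    intro h0
    apply hne
    ext t
    rw [hup, hvq, sub_eq_zero.mp h0]
  have h1 : (Finset.univ.filter fun t => u t = v t).card ≤ d := by
    refine le_trans (Finset.card_le_card ?_) ((Multiset.toFinset_card_le _).trans
      ((card_roots' (p - q)).trans ((natDegree_sub_le p q).trans (max_le hp hq))))
    intro t ht
    have ht' := (Finset.mem_filter.mp ht).2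
    rw [Multiset.mem_toFinset, mem_roots hpq, IsRoot.def, eval_sub, ← hup, ← hvq, ht', sub_self]
  have h2 := Finset.card_filter_add_card_filter_not (s := (Finset.univ : Finset F))
    (fun t => u t = v t)
  rw [Finset.card_univ] at h2
  have h3 : hammingDist u v = (Finset.univ.filter fun t => ¬ u t = v t).card := rfl
  omega

theorem card_filter_prod_eq_sum {α β : Type*} [Fintype α] [Fintype β] (p : α → β → Prop)
    [DecidablePred fun s : α × β => p s.1 s.2] [∀ i, DecidablePred (p i)] :
    (Finset.univ.filter fun s : α × β => p s.1 s.2).card =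
      ∑ i, (Finset.univ.filter fun j => p i j).card := by
  simp only [Finset.card_filter, Fintype.sum_prod_type]

theorem card_filter_prod_eq_sum_right {α β : Type*} [Fintype α] [Fintype β] (p : α → β → Prop)
    [DecidablePred fun s : α × β => p s.1 s.2] [∀ j, DecidablePred fun i => p i j] :
    (Finset.univ.filter fun s : α × β => p s.1 s.2).card =
      ∑ j, (Finset.univ.filter fun i => p i j).card := by
  simp only [Finset.card_filter, Fintype.sum_prod_type_right]

open Classical in
/-- A row of the grid that differs from `Q` disagrees with the columns on most of the columns
that come from `Q`. -/
theorem card_mul_le_card_disagreement (R C Q : F → F → F) (d : ℕ)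
    (hR : ∀ i, IsLowDegree d (R i)) (hQ : ∀ i, IsLowDegree d (Q i)) (A K : Finset F)
    (hA : ∀ i ∈ A, Q i ≠ R i) (hK : ∀ j ∉ K, ∀ i, Q i j = C i j) :
    A.card * (Fintype.card F - d - K.card) ≤
      (Finset.univ.filter fun s : F × F => s.1 ∈ A ∧ s.2 ∉ K ∧ R s.1 s.2 ≠ C s.1 s.2).card := by
  rw [card_filter_prod_eq_sum (fun i j => i ∈ A ∧ j ∉ K ∧ R i j ≠ C i j)]
  refine le_trans ?_ (Finset.sum_le_sum_of_subset (Finset.subset_univ A))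
  rw [← smul_eq_mul]
  refine Finset.card_nsmul_le_sum _ _ _ fun i hi => ?_
  have h1 : Fintype.card F ≤ hammingDist (Q i) (R i) + d := by
    by_contra hlt
    exact hA i hi ((hQ i).eq_of_hammingDist_lt (hR i) (by omega))
  have h2 : hammingDist (Q i) (R i) ≤
      (Finset.univ.filter fun j => i ∈ A ∧ j ∉ K ∧ R i j ≠ C i j).card + K.card := by
    refine (Finset.card_le_card (t := (Finset.univ.filter fun j =>
      i ∈ A ∧ j ∉ K ∧ R i j ≠ C i j) ∪ K) ?_).trans (Finset.card_union_le _ _)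
    intro j hj
    have hj' := (Finset.mem_filter.mp hj).2
    rw [Finset.mem_union, Finset.mem_filter]
    by_cases hjK : j ∈ K
    · exact Or.inr hjK
    · exact Or.inl ⟨Finset.mem_univ _, hi, hjK, fun h => hj' (by rw [hK j hjK, h])⟩
  omega

open Classical in
/-- Rows and columns of degree at most `d` that disagree on slightly less than a quarter of the
grid agree with a single function `Q` of bidegree at most `(d, d)`, up to a quarter of the rows
and a quarter of the columns. -/
theorem exists_grid_function (R C : F → F → F) (d : ℕ) (ε : ℝ) (hε : 0 < ε)
    (hR : ∀ i, IsLowDegree d (R i)) (hC : ∀ j, IsLowDegree d fun i => C i j)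
    (hd : (d : ℝ) < ε * Fintype.card F)
    (hS : ((Finset.univ.filter fun s : F × F => R s.1 s.2 ≠ C s.1 s.2).card : ℝ) ≤
      (1 / 4 - ε) * (Fintype.card F : ℝ) ^ 2) :
    ∃ Q : F → F → F, (∀ i, IsLowDegree d (Q i)) ∧ (∀ j, IsLowDegree d fun i => Q i j) ∧
      4 * (Finset.univ.filter fun i => Q i ≠ R i).card ≤ Fintype.card F ∧
      4 * (Finset.univ.filter fun j => (fun i => Q i j) ≠ fun i => C i j).card
        ≤ Fintype.card F := by
  set n := Fintype.card F with hn
  have hn0 : (0 : ℝ) < n := by exact_mod_cast Fintype.card_pos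
  have hε4 : ε ≤ 1 / 4 := by
    by_contra hlt
    push Not at hlt
    have : (1 / 4 - ε) * (n : ℝ) ^ 2 < 0 := mul_neg_of_neg_of_pos (by linarith) (by positivity)
    have : (0 : ℝ) ≤ (Finset.univ.filter fun s : F × F => R s.1 s.2 ≠ C s.1 s.2).card :=
      Nat.cast_nonneg _
    linarith
  choose Rp hRp hRe using hR
  choose Cp hCp hCe using hC
  -- With this `e`, the square `(e + 1) ^ 2` still exceeds the number of disagreements because
  -- `1 / 4 - ε ≤ (1 / 2 - ε) ^ 2`.
  set e := ⌊(1 / 2 - ε) * n⌋₊ with he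
  have he1 : (e : ℝ) ≤ (1 / 2 - ε) * n := Nat.floor_le (mul_nonneg (by linarith) hn0.le)
  have he2 : (1 / 2 - ε) * n < e + 1 := Nat.lt_floor_add_one _
  have hed : 2 * e + 2 * d < n := by
    have : (2 * e + 2 * d : ℝ) < n := by nlinarith
    exact_mod_cast this
  obtain ⟨Q, hQY, hQX, hQr, hQc⟩ := exists_bivariate_of_card_lt Rp Cp d e hRp hCp (by
    have h1 : (Finset.univ.filter fun s : F × F => (Rp s.1).eval s.2 ≠ (Cp s.2).eval s.1) =
        Finset.univ.filter fun s : F × F => R s.1 s.2 ≠ C s.1 s.2 := by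
      refine Finset.filter_congr fun s _ => ?_
      rw [hRe, show C s.1 s.2 = (Cp s.2).eval s.1 from hCe s.2 s.1]
    rw [h1]
    have h2 : ((1 / 2 - ε) * n) ^ 2 < ((e : ℝ) + 1) ^ 2 :=
      pow_lt_pow_left₀ he2 (mul_nonneg (by linarith) hn0.le) two_ne_zero
    have h3 : (1 / 4 - ε) * (n : ℝ) ^ 2 ≤ ((1 / 2 - ε) * n) ^ 2 := by
      rw [mul_pow]
      exact mul_le_mul_of_nonneg_right (by nlinarith) (by positivity)
    exact_mod_cast hS.trans_lt (h3.trans_lt h2)) hed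
  set q : F → F → F := fun i j => (Q.map (evalRingHom i)).eval j with hq
  have hqr : ∀ i, IsLowDegree d (q i) := fun i =>
    ⟨Q.map (evalRingHom i), natDegree_map_le.trans hQY, fun _ => rfl⟩
  have hqc : ∀ j, IsLowDegree d fun i => q i j := fun j =>
    ⟨(swap Q).map (evalRingHom j), natDegree_map_le.trans hQX, fun i => by
      rw [eval_map_evalRingHom_swap]⟩
  set B := Finset.univ.filter fun i => q i ≠ R i with hB
  set K := Finset.univ.filter fun j => (fun i => q i j) ≠ fun i => C i j with hK
  have hBe : B.card ≤ e := by
    refine (Finset.card_le_card fun i hi => ?_).trans hQr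
    simp only [hB, Finset.mem_filter, Finset.mem_univ, true_and] at hi ⊢
    intro h
    exact hi (funext fun j => by rw [hRe, ← h])
  have hKe : K.card ≤ e := by
    refine (Finset.card_le_card fun j hj => ?_).trans hQc
    simp only [hK, Finset.mem_filter, Finset.mem_univ, true_and] at hj ⊢
    intro h
    exact hj (funext fun i => by
      rw [show C i j = (Cp j).eval i from hCe j i, ← h, eval_map_evalRingHom_swap])
  have hBn : ∀ i ∉ B, ∀ j, q i j = R i j := by
    intro i hi j
    have : q i = R i := by simpa [hB] using hi
    rw [this]
  have hKn : ∀ j ∉ K, ∀ i, q i j = C i j := by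
    intro j hj i
    have : (fun i => q i j) = fun i => C i j := by simpa [hK] using hj
    exact congrFun this i
  have hR' : ∀ i, IsLowDegree d (R i) := fun i => ⟨Rp i, hRp i, hRe i⟩
  have hC' : ∀ j, IsLowDegree d fun i => C i j := fun j => ⟨Cp j, hCp j, hCe j⟩
  have k1 := card_mul_le_card_disagreement R C q d hR' hqr B K
    (fun i hi => (Finset.mem_filter.mp hi).2) hKn
  have k2 := card_mul_le_card_disagreement (fun j i => C i j) (fun j i => R i j)
    (fun j i => q i j) d hC' hqc K B (fun j hj => (Finset.mem_filter.mp hj).2) hBn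
  have k3 : (Finset.univ.filter fun s : F × F =>
        s.1 ∈ B ∧ s.2 ∉ K ∧ R s.1 s.2 ≠ C s.1 s.2).card +
      (Finset.univ.filter fun s : F × F =>
        s.1 ∈ K ∧ s.2 ∉ B ∧ C s.2 s.1 ≠ R s.2 s.1).card ≤
      (Finset.univ.filter fun s : F × F => R s.1 s.2 ≠ C s.1 s.2).card := by
    rw [card_filter_prod_eq_sum_right (fun i j => i ∈ K ∧ j ∉ B ∧ C j i ≠ R j i),
      ← card_filter_prod_eq_sum (fun j i => i ∈ K ∧ j ∉ B ∧ C j i ≠ R j i),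
      ← Finset.card_union_of_disjoint]
    · refine Finset.card_le_card fun s hs => ?_
      simp only [Finset.mem_union, Finset.mem_filter, Finset.mem_univ, true_and] at hs ⊢
      rcases hs with hs | hs
      · exact hs.2.2
      · exact hs.2.2.symm
    · rw [Finset.disjoint_left]
      intro s hs hs'
      simp only [Finset.mem_filter, Finset.mem_univ, true_and] at hs hs'
      exact hs'.2.1 hs.1
  set r := B.card
  set k := K.card
  have hre : r + d ≤ n := by omega
  have hke : k + d ≤ n := by omega
  -- Bad rows on good columns and bad columns on good rows are disjoint sources of disagreement.
  have k4 : (r : ℝ) * (n - d - k) + k * (n - d - r) ≤ (1 / 4 - ε) * (n : ℝ) ^ 2 := by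
    refine le_trans ?_ hS
    have := (Nat.add_le_add k1 k2).trans k3
    have h5 : (((r * (n - d - k) + k * (n - d - r) : ℕ)) : ℝ) =
        (r : ℝ) * (n - d - k) + k * (n - d - r) := by
      push_cast [Nat.cast_sub (show d ≤ n by omega), Nat.cast_sub (show k ≤ n - d by omega),
        Nat.cast_sub (show r ≤ n - d by omega)]
      ring
    rw [← h5]
    exact_mod_cast this
  have hr2 : (2 * r : ℝ) ≤ n := by exact_mod_cast (show 2 * r ≤ n by omega)
  have hk2 : (2 * k : ℝ) ≤ n := by exact_mod_cast (show 2 * k ≤ n by omega)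
  have hr0 : (0 : ℝ) ≤ r := Nat.cast_nonneg _
  have hk0 : (0 : ℝ) ≤ k := Nat.cast_nonneg _
  have hd0 : (0 : ℝ) ≤ d := Nat.cast_nonneg _
  have hrk : (d : ℝ) * (r + k) ≤ ε * n * n :=
    mul_le_mul hd.le (by linarith) (by positivity) (by positivity)
  refine ⟨q, hqr, hqc, ?_, ?_⟩
  · have h6 : (r : ℝ) * n ≤ 1 / 4 * n * n := by nlinarith [mul_nonneg hk0 (sub_nonneg.mpr hr2)]
    have h7 := le_of_mul_le_mul_right h6 hn0
    have : (4 * r : ℝ) ≤ n := by linarith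
    exact_mod_cast this
  · have h6 : (k : ℝ) * n ≤ 1 / 4 * n * n := by nlinarith [mul_nonneg hr0 (sub_nonneg.mpr hk2)]
    have h7 := le_of_mul_le_mul_right h6 hn0
    have : (4 * k : ℝ) ≤ n := by linarith
    exact_mod_cast this

open Classical in
/-- A best fit of `φ` coincides with any low-degree function that is close enough to `φ`. -/
theorem IsBestFit.eq_of_close {d : ℕ} {u v φ : F → F} (hu : IsBestFit d u φ)
    (hv : IsLowDegree d v) (h : 8 * hammingDist v φ ≤ 3 * Fintype.card F)
    (hd : 4 * d < Fintype.card F) : u = v := by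
  refine hu.1.eq_of_hammingDist_lt hv ?_
  have h1 := hu.2 v hv
  have h2 := hammingDist_triangle u φ v
  rw [hammingDist_comm φ v] at h2
  omega

open Classical in
/-- The row polynomial and the column polynomial through the point `(i₀, j₀)` of the grid agree
there, provided that both are best fits and that rows and columns predict the values on the
row `i₀` and on the column `j₀` well. -/
theorem grid_row_eq_col (R C : F → F → F) (d : ℕ) (ε : ℝ) (hε : 0 < ε)
    (hR : ∀ i, IsLowDegree d (R i)) (hC : ∀ j, IsLowDegree d fun i => C i j)
    (hd : (d : ℝ) < ε * Fintype.card F)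
    (hS : ((Finset.univ.filter fun s : F × F => R s.1 s.2 ≠ C s.1 s.2).card : ℝ) ≤
      (1 / 4 - ε) * (Fintype.card F : ℝ) ^ 2) (i₀ j₀ : F) (φ ψ : F → F)
    (hφ : IsBestFit d (R i₀) φ) (hCφ : 8 * hammingDist (C i₀) φ ≤ Fintype.card F)
    (hψ : IsBestFit d (fun i => C i j₀) ψ)
    (hRψ : 8 * hammingDist (fun i => R i j₀) ψ ≤ Fintype.card F) :
    R i₀ j₀ = C i₀ j₀ := by
  obtain ⟨Q, hQr, hQc, hB, hK⟩ := exists_grid_function R C d ε hε hR hC hd hS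
  have hd4 : 4 * d < Fintype.card F := by
    have hn0 : (0 : ℝ) < Fintype.card F := by exact_mod_cast Fintype.card_pos
    have hε4 : ε ≤ 1 / 4 := by
      by_contra hlt
      push Not at hlt
      have : (1 / 4 - ε) * (Fintype.card F : ℝ) ^ 2 < 0 :=
        mul_neg_of_neg_of_pos (by linarith) (by positivity)
      have : (0 : ℝ) ≤ (Finset.univ.filter fun s : F × F => R s.1 s.2 ≠ C s.1 s.2).card :=
        Nat.cast_nonneg _
      linarith
    have : (4 * d : ℝ) < Fintype.card F := by nlinarith
    exact_mod_cast this
  have h1 : R i₀ = Q i₀ := by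
    refine hφ.eq_of_close (hQr i₀) ?_ hd4
    have h2 := hammingDist_triangle (Q i₀) (C i₀) φ
    have h3 : hammingDist (Q i₀) (C i₀) ≤
        (Finset.univ.filter fun j => (fun i => Q i j) ≠ fun i => C i j).card := by
      refine Finset.card_le_card fun j hj => ?_
      simp only [Finset.mem_filter, Finset.mem_univ, true_and] at hj ⊢
      exact fun h => hj (congrFun h i₀)
    omega
  have h2 : (fun i => C i j₀) = fun i => Q i j₀ := by
    refine hψ.eq_of_close (hQc j₀) ?_ hd4
    have h2 := hammingDist_triangle (fun i => Q i j₀) (fun i => R i j₀) ψ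
    have h3 : hammingDist (fun i => Q i j₀) (fun i => R i j₀) ≤
        (Finset.univ.filter fun i => Q i ≠ R i).card := by
      refine Finset.card_le_card fun i hi => ?_
      simp only [Finset.mem_filter, Finset.mem_univ, true_and] at hi ⊢
      exact fun h => hi (congrFun h j₀)
    omega
  rw [h1]
  exact (congrFun h2 i₀).symm

end

/-! ### Functions of low degree on every line -/

section

open MvPolynomial

variable {F : Type*} [Field F]

/-- Restricting a polynomial to a line through the origin turns the homogeneous components into
the coefficients of the powers of the parameter. -/
theorem eval_smul_eq_sum {m : ℕ} (G : MvPolynomial (Fin m) F) (h : Fin m → F) (t : F) :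
    eval (t • h) G =
      ∑ k ∈ Finset.range (G.totalDegree + 1), t ^ k * eval h (homogeneousComponent k G) := by
  conv_lhs => rw [← sum_homogeneousComponent G]
  rw [map_sum]
  refine Finset.sum_congr rfl fun k _ => ?_
  rw [eval_eq', eval_eq', Finset.mul_sum]
  refine Finset.sum_congr rfl fun e he => ?_
  have h1 : ∑ i, e i = k := by
    rw [← Finsupp.degree_eq_sum, Finsupp.degree_eq_weight_one]
    exact homogeneousComponent_isHomogeneous k G (mem_support_iff.mp he)
  simp only [Pi.smul_apply, smul_eq_mul, mul_pow, Finset.prod_mul_distrib,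
    Finset.prod_pow_eq_pow_sum, h1]
  ring

variable [Fintype F]

/-- A polynomial of total degree less than `|F|` whose restrictions to the lines through the
origin have degree at most `d` has total degree at most `d`. -/
theorem totalDegree_le_of_forall_line {m d : ℕ} (G : MvPolynomial (Fin m) F)
    (hG : G.totalDegree < Fintype.card F) (hd : d < Fintype.card F)
    (h : ∀ h : Fin m → F, IsLowDegree d fun t => eval (t • h) G) :
    G.totalDegree ≤ d := by
  have key : ∀ k, d < k → k ≤ G.totalDegree → homogeneousComponent k G = 0 := by
    intro k hdk hk
    refine (homogeneousComponent_isHomogeneous k G).eq_zero_of_forall_eval_eq_zero_of_le_card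
      (fun v => ?_) (by rw [Cardinal.mk_fintype]; exact_mod_cast (hk.trans_lt hG).le)
    obtain ⟨p, hp, hpe⟩ := h v
    set q : Polynomial F := ∑ k ∈ Finset.range (G.totalDegree + 1),
      Polynomial.C (eval v (homogeneousComponent k G)) * Polynomial.X ^ k with hq
    have hpq : q = p := by
      refine eq_of_natDegree_lt_card (fun t => ?_) ?_ (hp.trans_lt hd)
      · rw [← hpe t]
        change _ = eval (t • v) G
        rw [eval_smul_eq_sum, hq, Polynomial.eval_finsetSum]
        refine Finset.sum_congr rfl fun k _ => ?_
        rw [Polynomial.eval_C_mul, Polynomial.eval_X_pow, mul_comm]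
      · refine lt_of_le_of_lt ?_ hG
        refine Polynomial.natDegree_sum_le_of_forall_le _ _ fun k hk => ?_
        exact (Polynomial.natDegree_C_mul_X_pow_le _ _).trans
          (Nat.lt_succ_iff.mp (Finset.mem_range.mp hk))
    have h1 : q.coeff k = 0 := by
      rw [hpq]; exact Polynomial.coeff_eq_zero_of_natDegree_lt (hp.trans_lt hdk)
    rw [hq, Polynomial.finsetSum_coeff] at h1
    simp only [Polynomial.coeff_C_mul_X_pow] at h1
    rw [Finset.sum_ite_eq, if_pos (Finset.mem_range.mpr (by omega))] at h1
    exact h1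
  rw [← sum_homogeneousComponent G]
  refine totalDegree_finsetSum_le fun k hk => ?_
  by_cases hdk : d < k
  · rw [key k hdk (by simpa [Nat.lt_succ_iff] using hk), totalDegree_zero]
    exact Nat.zero_le d
  · exact (homogeneousComponent_isHomogeneous k G).totalDegree_le.trans (not_lt.mp hdk)

/-- A function on `F ^ m` whose restriction to every line has degree at most `d` is a polynomial
of total degree at most `d` if `|F| > 2 d`. By induction on `m`, interpolation in the first
variable yields a polynomial of total degree at most `2 d`, and the lines through the origin then
bound its degree by `d`. -/
theorem exists_mvPolynomial_of_forall_line {d : ℕ} (hd : 2 * d < Fintype.card F) (m : ℕ)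
    (g : (Fin m → F) → F)
    (hg : ∀ h x : Fin m → F, IsLowDegree d fun t => g (x + t • h)) :
    ∃ G : MvPolynomial (Fin m) F, G.totalDegree ≤ d ∧ ∀ x, eval x G = g x := by
  classical
  induction m with
  | zero =>
    refine ⟨C (g default), by simp, fun x => ?_⟩
    rw [eval_C, Subsingleton.elim x default]
  | succ m ih =>
    have hcons : ∀ a : F, ∃ G : MvPolynomial (Fin m) F, G.totalDegree ≤ d ∧
        ∀ x, eval x G = g (Fin.cons a x) := by
      intro a
      refine ih (fun x => g (Fin.cons a x)) fun h x => ?_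
      have := hg (Fin.cons 0 h) (Fin.cons a x)
      convert this using 3 with t
      refine funext fun i => ?_
      refine Fin.cases ?_ (fun j => ?_) i <;> simp
    choose G hGd hGe using hcons
    obtain ⟨I, -, hI⟩ := Finset.exists_subset_card_eq (s := (Finset.univ : Finset F))
      (n := d + 1) (by rw [Finset.card_univ]; omega)
    have hinj : Set.InjOn (id : F → F) (I : Set F) := Function.injective_id.injOn
    set H : MvPolynomial (Fin (m + 1)) F := ∑ a ∈ I,
      rename Fin.succ (G a) * Polynomial.aeval (X 0) (Lagrange.basis I id a) with hH
    have haeval : ∀ (p : Polynomial F) (x : Fin (m + 1) → F),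
        eval x (Polynomial.aeval (X 0 : MvPolynomial (Fin (m + 1)) F) p) = p.eval (x 0) := by
      intro p x
      induction p using Polynomial.induction_on' with
      | add p q hp hq => simp [hp, hq]
      | monomial k r => simp [Polynomial.aeval_monomial, algebraMap_eq]
    have hdeg : ∀ p : Polynomial F,
        (Polynomial.aeval (X 0 : MvPolynomial (Fin (m + 1)) F) p).totalDegree ≤ p.natDegree := by
      intro p
      rw [Polynomial.aeval_eq_sum_range]
      refine totalDegree_finsetSum_le fun k hk => ?_
      refine (totalDegree_smul_le _ _).trans ((totalDegree_pow _ _).trans ?_)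
      rw [totalDegree_X, mul_one]
      exact Nat.lt_succ_iff.mp (Finset.mem_range.mp hk)
    have hHe : ∀ x, eval x H = g x := by
      intro x
      obtain ⟨p, hp, hpe⟩ := hg (Fin.cons 1 0) (Fin.cons 0 (Fin.tail x))
      have hline : ∀ t : F, g (Fin.cons t (Fin.tail x)) = p.eval t := by
        intro t
        rw [← hpe]
        congr 1
        refine funext fun i => ?_
        refine Fin.cases ?_ (fun j => ?_) i <;> simp
      have h1 : p = Lagrange.interpolate I id fun a => g (Fin.cons a (Fin.tail x)) := by
        refine Lagrange.eq_interpolate_of_eval_eq _ hinj ?_ fun a _ => (hline a).symm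
        refine lt_of_le_of_lt Polynomial.degree_le_natDegree ?_
        rw [hI]
        exact_mod_cast Nat.lt_succ_of_le hp
      have h2 := hline (x 0)
      rw [Fin.cons_self_tail] at h2
      rw [h2, h1, Lagrange.interpolate_apply, Polynomial.eval_finsetSum, hH, map_sum]
      refine Finset.sum_congr rfl fun a _ => ?_
      rw [map_mul, eval_rename, haeval, Polynomial.eval_mul, Polynomial.eval_C, ← hGe]
      rfl
    have hHd : H.totalDegree ≤ 2 * d := by
      refine totalDegree_finsetSum_le fun a ha => ?_
      refine (totalDegree_mul _ _).trans ?_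
      have h1 := (totalDegree_rename_le Fin.succ (G a)).trans (hGd a)
      have h2 := hdeg (Lagrange.basis I id a)
      rw [Lagrange.natDegree_basis hinj ha, hI] at h2
      omega
    refine ⟨H, ?_, hHe⟩
    refine totalDegree_le_of_forall_line H (hHd.trans_lt hd) (by omega) fun h => ?_
    simpa [hHe] using hg h 0

end

/-- The average of a real function over the uniform distribution on a finite type. -/
noncomputable def mean {α : Type*} [Fintype α] (f : α → ℝ) : ℝ :=
  (∑ a, f a) / Fintype.card α

/-- The map `L` pushes the uniform distribution on `Ω` forward to the uniform one on `W`. -/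
def IsUniformMap {Ω W : Type*} [Fintype Ω] [Fintype W] (L : Ω → W) : Prop :=
  ∀ f : W → ℝ, mean (fun ω => f (L ω)) = mean f

/-! ### Averages over the uniform distribution -/

section Probability

variable {α β Ω W ι : Type*} [Fintype α] [Fintype β] [Fintype Ω] [Fintype W] [Fintype ι]

theorem mean_mono {f g : α → ℝ} (h : ∀ a, f a ≤ g a) : mean f ≤ mean g :=
  div_le_div_of_nonneg_right (Finset.sum_le_sum fun a _ => h a) (Nat.cast_nonneg _)

theorem mean_nonneg {f : α → ℝ} (h : ∀ a, 0 ≤ f a) : 0 ≤ mean f :=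
  div_nonneg (Finset.sum_nonneg fun a _ => h a) (Nat.cast_nonneg _)

theorem mean_add (f g : α → ℝ) : mean (fun a => f a + g a) = mean f + mean g := by
  simp only [mean, Finset.sum_add_distrib, add_div]

theorem mean_mul_left (r : ℝ) (f : α → ℝ) : mean (fun a => r * f a) = r * mean f := by
  simp only [mean, ← Finset.mul_sum, mul_div_assoc]

theorem mean_sum (f : ι → α → ℝ) : mean (fun a => ∑ i, f i a) = ∑ i, mean (f i) := by
  simp only [mean]
  rw [Finset.sum_comm, Finset.sum_div]

theorem mean_const [Nonempty α] (r : ℝ) : mean (fun _ : α => r) = r := by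
  have : (Fintype.card α : ℝ) ≠ 0 := by exact_mod_cast Fintype.card_ne_zero
  simp only [mean, Finset.sum_const, Finset.card_univ, nsmul_eq_mul]
  field_simp

theorem mean_prod (f : α × β → ℝ) : mean f = mean fun a => mean fun b => f (a, b) := by
  simp only [mean, Fintype.sum_prod_type, Fintype.card_prod, Nat.cast_mul]
  rw [← Finset.sum_div, div_div, mul_comm (Fintype.card α : ℝ)]

theorem mean_comm (f : α → β → ℝ) :
    (mean fun a => mean fun b => f a b) = mean fun b => mean fun a => f a b := by
  simp only [mean, ← Finset.sum_div]
  rw [Finset.sum_comm, div_right_comm]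

theorem exists_le_mean [Nonempty α] (f : α → ℝ) : ∃ a, f a ≤ mean f := by
  by_contra! h
  have hc : (0 : ℝ) < Fintype.card α := by exact_mod_cast Fintype.card_pos
  have h1 : ∑ _a : α, mean f < ∑ a, f a :=
    Finset.sum_lt_sum_of_nonempty Finset.univ_nonempty fun a _ => h a
  rw [Finset.sum_const, Finset.card_univ, nsmul_eq_mul, mean, mul_div_cancel₀ _ hc.ne'] at h1
  exact lt_irrefl _ h1

open Classical in
theorem uniformProb_eq_mean (p : α → Prop) :
    uniformProb p = mean fun a => if p a then (1 : ℝ) else 0 := by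
  simp [uniformProb, mean]

theorem uniformProb_nonneg (p : α → Prop) : 0 ≤ uniformProb p :=
  div_nonneg (Nat.cast_nonneg _) (Nat.cast_nonneg _)

theorem uniformProb_mono {p q : α → Prop} (h : ∀ a, p a → q a) :
    uniformProb p ≤ uniformProb q := by
  classical
  rw [uniformProb_eq_mean, uniformProb_eq_mean]
  refine mean_mono fun a => ?_
  by_cases hp : p a
  · simp [hp, h a hp]
  · rw [if_neg hp]; positivity

theorem uniformProb_le_one (p : α → Prop) : uniformProb p ≤ 1 := by
  classical
  refine div_le_one_of_le₀ ?_ (Nat.cast_nonneg _)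
  exact_mod_cast Finset.card_le_univ _

theorem uniformProb_or_le (p q : α → Prop) :
    uniformProb (fun a => p a ∨ q a) ≤ uniformProb p + uniformProb q := by
  classical
  simp only [uniformProb_eq_mean]
  rw [← mean_add]
  refine mean_mono fun a => ?_
  by_cases hp : p a <;> by_cases hq : q a <;> simp [hp, hq]

theorem uniformProb_le_add {p q r : α → Prop} (h : ∀ a, p a → q a ∨ r a) :
    uniformProb p ≤ uniformProb q + uniformProb r :=
  (uniformProb_mono h).trans (uniformProb_or_le q r)

theorem exists_not_of_uniformProb_lt_one [Nonempty α] (p : α → Prop) (h : uniformProb p < 1) :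
    ∃ a, ¬ p a := by
  classical
  by_contra! hp
  rw [uniformProb_eq_mean] at h
  simp only [hp, if_true, mean_const, lt_irrefl] at h

theorem uniformProb_prod (p : α × β → Prop) :
    uniformProb p = mean fun a => uniformProb fun b => p (a, b) := by
  classical
  rw [uniformProb_eq_mean, mean_prod]
  simp only [uniformProb_eq_mean]

theorem uniformProb_prod_right (p : α × β → Prop) :
    uniformProb p = mean fun b => uniformProb fun a => p (a, b) := by
  classical
  rw [uniformProb_eq_mean, mean_prod, mean_comm]
  simp only [uniformProb_eq_mean]

theorem IsUniformMap.uniformProb_comp {L : Ω → W} (hL : IsUniformMap L) (p : W → Prop) :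
    uniformProb (fun ω => p (L ω)) = uniformProb p := by
  classical
  rw [uniformProb_eq_mean, uniformProb_eq_mean]
  exact hL fun w => if p w then 1 else 0

theorem IsUniformMap.of_bijective {L : Ω → W} (hL : Function.Bijective L) : IsUniformMap L := by
  intro f
  rw [mean, mean, Fintype.card_of_bijective hL, hL.sum_comp f]

theorem IsUniformMap.of_injective {L : Ω → Ω} (hL : Function.Injective L) : IsUniformMap L :=
  .of_bijective (Finite.injective_iff_bijective.mp hL)

theorem IsUniformMap.fst [Nonempty β] : IsUniformMap (Prod.fst : α × β → α) := by
  intro f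
  rw [mean_prod]
  simp only [mean_const]

theorem IsUniformMap.snd [Nonempty α] : IsUniformMap (Prod.snd : α × β → β) := by
  intro f
  rw [mean_prod]
  simp only [mean_const]

theorem IsUniformMap.comp {L : Ω → W} {M : W → α} (hM : IsUniformMap M) (hL : IsUniformMap L) :
    IsUniformMap fun ω => M (L ω) :=
  fun f => (hL fun w => f (M w)).trans (hM f)

/-- Markov's inequality for the number of events that occur. -/
theorem mul_uniformProb_lt_card_le (A : ι → Ω → Prop) [∀ ω, DecidablePred fun i => A i ω]
    (q : ι → ℝ)
    (h : ∀ i, uniformProb (A i) ≤ q i) (t : ℝ) :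
    t * uniformProb (fun ω => t < ((Finset.univ.filter fun i => A i ω).card : ℝ)) ≤
      ∑ i, q i := by
  classical
  refine le_trans ?_ (Finset.sum_le_sum fun i _ => h i)
  simp only [uniformProb_eq_mean]
  rw [← mean_sum, ← mean_mul_left]
  refine mean_mono fun ω => ?_
  refine le_of_le_of_eq (b := ((Finset.univ.filter fun i => A i ω).card : ℝ)) ?_
    (by
      rw [Finset.card_filter]
      push_cast
      refine Finset.sum_congr rfl fun i _ => ?_
      congr)
  split_ifs with hlt
  · linarith
  · rw [mul_zero]; exact Nat.cast_nonneg _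

/-- Chebyshev's inequality for a sum of pairwise independent random variables with values in
`[0, 1]` and common mean. Pairwise independence is expressed by the uniformity of the pairs
`(L i ω, L k ω)`. -/
theorem uniformProb_lt_sum_le [Nonempty ι] [Nonempty W] (L : ι → Ω → W) (Φ : W → ℝ)
    (h0 : ∀ w, 0 ≤ Φ w) (h1 : ∀ w, Φ w ≤ 1) (hL : ∀ i, IsUniformMap (L i))
    (hLL : ∀ i k, i ≠ k → IsUniformMap fun ω => (L i ω, L k ω)) (ε : ℝ) (hε : 0 < ε) :
    uniformProb (fun ω => (mean Φ + ε) * Fintype.card ι < ∑ i, Φ (L i ω)) ≤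
      1 / (ε ^ 2 * Fintype.card ι) := by
  classical
  set μ := mean Φ with hμ
  set n : ℝ := (Fintype.card ι : ℝ) with hn
  have hn0 : 0 < n := by rw [hn]; exact_mod_cast Fintype.card_pos
  have hμ0 : 0 ≤ μ := mean_nonneg h0
  have hμ1 : μ ≤ 1 := (mean_mono h1).trans (mean_const (α := W) 1).le
  set Ψ : W → ℝ := fun w => Φ w - μ with hΨ
  have hΨ0 : mean Ψ = 0 := by
    have : mean Ψ = mean Φ + mean fun _ : W => -μ := by
      rw [← mean_add]; rfl
    rw [this, mean_const, hμ]; ring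
  have hoff : ∀ i k, i ≠ k → mean (fun ω => Ψ (L i ω) * Ψ (L k ω)) = 0 := by
    intro i k hik
    rw [hLL i k hik fun w => Ψ w.1 * Ψ w.2, mean_prod]
    simp only [mean_mul_left, hΨ0, mul_zero]
    exact mean_const 0
  have hdiag : ∀ i, mean (fun ω => Ψ (L i ω) * Ψ (L i ω)) ≤ 1 := by
    intro i
    rw [hL i fun w => Ψ w * Ψ w]
    refine (mean_mono fun w => ?_).trans (mean_const (α := W) 1).le
    have := h0 w
    have := h1 w
    simp only [hΨ]
    nlinarith
  have hsq : mean (fun ω => (∑ i, Ψ (L i ω)) ^ 2) ≤ n := by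
    have : (fun ω => (∑ i, Ψ (L i ω)) ^ 2) = fun ω => ∑ i, ∑ k, Ψ (L i ω) * Ψ (L k ω) := by
      ext ω
      rw [sq, Finset.sum_mul_sum]
    rw [this, mean_sum]
    calc ∑ i, mean (fun ω => ∑ k, Ψ (L i ω) * Ψ (L k ω)) ≤ ∑ _i : ι, (1 : ℝ) := by
          refine Finset.sum_le_sum fun i _ => ?_
          rw [mean_sum, Finset.sum_eq_single i (fun k _ hk => hoff i k hk.symm) (by simp)]
          exact hdiag i
      _ = n := by simp [hn]
  have hmarkov : (ε * n) ^ 2 *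
      uniformProb (fun ω => (μ + ε) * n < ∑ i, Φ (L i ω)) ≤ n := by
    refine le_trans ?_ hsq
    rw [uniformProb_eq_mean, ← mean_mul_left]
    refine mean_mono fun ω => ?_
    split_ifs with hlt
    · rw [mul_one]
      refine pow_le_pow_left₀ (by positivity) ?_ 2
      simp only [hΨ, Finset.sum_sub_distrib, Finset.sum_const, Finset.card_univ, nsmul_eq_mul]
      rw [← hn]; linarith
    · rw [mul_zero]; positivity
  rw [le_div_iff₀ (by positivity)]
  have : n * (uniformProb (fun ω => (μ + ε) * n < ∑ i, Φ (L i ω)) * (ε ^ 2 * n)) ≤ n * 1 := by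
    calc _ = (ε * n) ^ 2 * uniformProb (fun ω => (μ + ε) * n < ∑ i, Φ (L i ω)) := by ring
      _ ≤ n * 1 := by rw [mul_one]; exact hmarkov
  exact le_of_mul_le_mul_left this hn0

end Probability

/-! ### Uniformity of random grids -/

section UniformMaps

variable {F V : Type*} [Field F] [AddCommGroup V] [Module F V]

theorem eq_and_eq_of_add_smul_eq {i k : F} (hik : i ≠ k) {a b a' b' : V}
    (h1 : a + i • b = a' + i • b') (h2 : a + k • b = a' + k • b') : a = a' ∧ b = b' := by
  have h3 : (i - k) • (b - b') = 0 := by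
    have h4 : (i - k) • (b - b') =
        (a + i • b - (a' + i • b')) - (a + k • b - (a' + k • b')) := by module
    rw [h4, h1, h2]; simp
  have h5 : b = b' :=
    sub_eq_zero.mp ((smul_eq_zero.mp h3).resolve_left (sub_ne_zero.mpr hik))
  subst h5
  exact ⟨add_right_cancel h1, rfl⟩

variable [Fintype V]

theorem isUniformMap_add_smul_left (t : F) :
    IsUniformMap fun w : V × V => (w.1 + t • w.2, w.2) := by
  refine .of_injective fun v w h => ?_
  obtain ⟨h1, h2⟩ := Prod.mk.inj h
  rw [h2] at h1
  exact Prod.ext (add_right_cancel h1) h2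

theorem isUniformMap_add_smul (t : F) : IsUniformMap fun w : V × V => w.1 + t • w.2 :=
  IsUniformMap.fst.comp (isUniformMap_add_smul_left t)

theorem isUniformMap_plane_snd (a : V) {i : F} (hi : i ≠ 0) (j : F) :
    IsUniformMap fun w : V × V => (a + i • w.1 + j • w.2, w.2) := by
  refine .of_injective fun v w h => ?_
  obtain ⟨h1, h2⟩ := Prod.mk.inj h
  rw [h2] at h1
  exact Prod.ext (smul_right_injective V hi (add_left_cancel (add_right_cancel h1))) h2

theorem isUniformMap_plane_fst (a : V) (i : F) {j : F} (hj : j ≠ 0) :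
    IsUniformMap fun w : V × V => (a + i • w.1 + j • w.2, w.1) := by
  refine .of_bijective (Finite.injective_iff_bijective.mp fun v w h => ?_)
  obtain ⟨h1, h2⟩ := Prod.mk.inj h
  rw [h2] at h1
  exact Prod.ext h2 (smul_right_injective V hj (add_left_cancel h1))

theorem isUniformMap_column (a h : V) (i : F) {j : F} (hj : j ≠ 0) :
    IsUniformMap fun w : V × V => (a + i • h + j • (w.1 + i • w.2), h + j • w.2) := by
  refine .of_injective fun v w hvw => ?_
  obtain ⟨h1, h2⟩ := Prod.mk.inj hvw
  have h3 : v.2 = w.2 := smul_right_injective V hj (add_left_cancel h2)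
  have h4 := smul_right_injective V hj (add_left_cancel h1)
  simp only [h3] at h4
  exact Prod.ext (add_right_cancel h4) h3

/-- Two different rows of a random bilinear grid are independent uniform lines. -/
theorem isUniformMap_rows {i k : F} (hik : i ≠ k) :
    IsUniformMap fun w : (V × V) × V × V =>
      ((w.1.1 + i • w.1.2, w.2.1 + i • w.2.2), (w.1.1 + k • w.1.2, w.2.1 + k • w.2.2)) := by
  refine .of_injective fun v w h => ?_
  obtain ⟨h1, h2⟩ := Prod.mk.inj h
  obtain ⟨h3, h4⟩ := Prod.mk.inj h1
  obtain ⟨h5, h6⟩ := Prod.mk.inj h2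
  obtain ⟨e1, e2⟩ := eq_and_eq_of_add_smul_eq hik h3 h5
  obtain ⟨e3, e4⟩ := eq_and_eq_of_add_smul_eq hik h4 h6
  exact Prod.ext (Prod.ext e1 e2) (Prod.ext e3 e4)

theorem isUniformMap_row (i : F) :
    IsUniformMap fun w : (V × V) × V × V => (w.1.1 + i • w.1.2, w.2.1 + i • w.2.2) :=
  IsUniformMap.fst.comp (isUniformMap_rows (V := V) (i := i) (k := i + 1) (by simp))

end UniformMaps

/-! ### Tables of line polynomials -/

section LineTable

open Polynomial

variable {F : Type*} [Field F]

theorem isLowDegree_const (d : ℕ) (r : F) : IsLowDegree d fun _ => r :=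
  ⟨C r, by simp, by simp⟩

variable [Fintype F]

open Classical in
theorem exists_isBestFit (d : ℕ) (φ : F → F) : ∃ u, IsBestFit d u φ := by
  obtain ⟨u, hu, hmin⟩ := Set.exists_min_image {u : F → F | IsLowDegree d u}
    (fun u => hammingDist u φ) (Set.toFinite _) ⟨_, isLowDegree_const d 0⟩
  exact ⟨u, hu, hmin⟩

open Classical in
theorem hammingDist_comp_equiv {α β : Type*} [Fintype α] (u φ : α → β) (e : α ≃ α) :
    hammingDist (fun t => u (e t)) (fun t => φ (e t)) = hammingDist u φ := by
  simp only [hammingDist, Finset.card_filter]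
  exact e.sum_comp fun t => if u t ≠ φ t then 1 else 0

theorem IsBestFit.comp_add {d : ℕ} {u φ : F → F} (h : IsBestFit d u φ) (s : F) :
    IsBestFit d (fun t => u (s + t)) (fun t => φ (s + t)) := by
  classical
  refine ⟨?_, fun v hv => ?_⟩
  · simpa [add_comm] using h.1.comp_affine 1 s
  · have h1 := h.2 (fun t => v (t - s)) (by simpa [sub_eq_add_neg] using hv.comp_affine 1 (-s))
    have h2 := hammingDist_comp_equiv u φ (Equiv.addLeft s)
    have h3 := hammingDist_comp_equiv (fun t => v (t - s)) φ (Equiv.addLeft s)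
    simp only [Equiv.coe_addLeft, add_sub_cancel_left] at h2 h3
    rw [← h2, ← h3] at h1
    exact h1

variable {V : Type*} [AddCommGroup V] [Module F V]

/-- A table `W` of line polynomials: `W h x` is the value at the point `x` of the polynomial
attached to the line through `x` in the direction `h`. Consistency along each line is built into
this encoding. -/
def IsLineTable (d : ℕ) (W : V → V → F) : Prop :=
  ∀ h x, IsLowDegree d fun t => W h (x + t • h)

/-- On every line, the table `W` carries a closest polynomial of degree at most `d` to `f`. -/
def IsOptimalTable (d : ℕ) (W : V → V → F) (f : V → F) : Prop :=
  ∀ h x, IsBestFit d (fun t => W h (x + t • h)) fun t => f (x + t • h)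

theorem IsOptimalTable.isLineTable {d : ℕ} {W : V → V → F} {f : V → F}
    (h : IsOptimalTable d W f) : IsLineTable d W := fun k x => (h k x).1

theorem exists_isOptimalTable (d : ℕ) (f : V → F) : ∃ W, IsOptimalTable d W f := by
  classical
  suffices H : ∀ h : V, ∃ w : V → F,
      ∀ x, IsBestFit d (fun t => w (x + t • h)) fun t => f (x + t • h) by
    choose W hW using H
    exact ⟨W, hW⟩
  intro h
  by_cases h0 : h = 0
  · refine ⟨f, fun x => ⟨?_, fun v _ => ?_⟩⟩
    · simpa [h0] using isLowDegree_const d (f x)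
    · rw [hammingDist_self]; exact Nat.zero_le _
  -- Every line in the direction `h` is parametrised from a chosen base point `r`.
  choose u hu using fun y : V => exists_isBestFit d fun t => f (y + t • h)
  let π := (Submodule.span F {h}).mkQ
  let r : V → V := fun x => Quotient.out (π x)
  have hr : ∀ x, ∃ s : F, x = r x + s • h := by
    intro x
    have h1 : π x = π (r x) := (Quotient.out_eq (π x)).symm
    have h2 : x - r x ∈ Submodule.span F {h} :=
      (Submodule.Quotient.eq _).mp h1
    obtain ⟨s, hs⟩ := Submodule.mem_span_singleton.mp h2
    exact ⟨s, by rw [hs]; abel⟩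
  choose σ hσ using hr
  have hrt : ∀ x (t : F), r (x + t • h) = r x := by
    intro x t
    have : π (x + t • h) = π x := by
      rw [map_add, add_eq_left]
      exact (Submodule.Quotient.mk_eq_zero _).mpr
        (Submodule.smul_mem _ _ (Submodule.mem_span_singleton_self h))
    simp only [r, this]
  have hσt : ∀ x (t : F), σ (x + t • h) = σ x + t := by
    intro x t
    have h1 := hσ (x + t • h)
    rw [hrt] at h1
    nth_rewrite 1 [hσ x] at h1
    rw [add_assoc, ← add_smul] at h1
    exact (smul_left_injective F h0 (add_left_cancel h1)).symm
  refine ⟨fun x => u (r x) (σ x), fun x => ?_⟩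
  have h1 := (hu (r x)).comp_add (σ x)
  have h2 : (fun t : F => f (x + t • h)) = fun t => f (r x + (σ x + t) • h) := by
    ext t
    rw [add_smul, ← add_assoc, ← hσ x]
  simp only [hrt, hσt, h2]
  exact h1

/-- The probability that the table `W` predicts a wrong value of `f` at a uniform point from a
uniform direction. -/
noncomputable def tableError [Fintype V] (W : V → V → F) (f : V → F) : ℝ :=
  uniformProb fun w : V × V => W w.2 w.1 ≠ f w.1

/-- Averaging over the points of the line first does not change the error of a table. -/
theorem mean_line_eq_tableError [Fintype V] (W : V → V → F) (f : V → F) :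
    (mean fun w : V × V => uniformProb fun t : F =>
      W w.2 (w.1 + t • w.2) ≠ f (w.1 + t • w.2)) = tableError W f := by
  rw [← uniformProb_prod fun w : (V × V) × F =>
    W w.1.2 (w.1.1 + w.2 • w.1.2) ≠ f (w.1.1 + w.2 • w.1.2), uniformProb_prod_right]
  have : ∀ t : F, uniformProb (fun w : V × V => W w.2 (w.1 + t • w.2) ≠ f (w.1 + t • w.2)) =
      tableError W f := fun t =>
    (isUniformMap_add_smul_left t).uniformProb_comp fun w : V × V => W w.2 w.1 ≠ f w.1
  simp only [this, mean_const]

/-- The error of an optimal table is at most the rejection probability of any family of line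
polynomials. -/
theorem IsOptimalTable.tableError_le [Fintype V] {d : ℕ} {W : V → V → F} {f : V → F}
    (hW : IsOptimalTable d W f) (U : V → V → F → F) (hU : ∀ x h, IsLowDegree d (U x h)) :
    tableError W f ≤
      mean fun w : V × V => uniformProb fun t : F => U w.1 w.2 t ≠ f (w.1 + t • w.2) := by
  classical
  rw [← mean_line_eq_tableError (F := F)]
  refine mean_mono fun w => ?_
  refine div_le_div_of_nonneg_right ?_ (Nat.cast_nonneg _)
  have := (hW w.2 w.1).2 (U w.1 w.2) (hU w.1 w.2)
  simp only [hammingDist] at this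
  exact_mod_cast this

end LineTable

/-! ### Random grids -/

section Grid

variable {F Ω : Type*} [Field F] [Fintype F] [Fintype Ω]

open Classical in
/-- The probabilistic form of `grid_row_eq_col` for a random grid. -/
theorem uniformProb_row_ne_col_le (R C : Ω → F → F → F) (d : ℕ) (ε : ℝ) (hε : 0 < ε)
    (hR : ∀ ω i, IsLowDegree d (R ω i)) (hC : ∀ ω j, IsLowDegree d fun i => C ω i j)
    (hd : (d : ℝ) < ε * Fintype.card F) (i₀ j₀ : F) (φ ψ : Ω → F → F)
    (hφ : ∀ ω, IsBestFit d (R ω i₀) (φ ω)) (hψ : ∀ ω, IsBestFit d (fun i => C ω i j₀) (ψ ω)) :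
    uniformProb (fun ω => R ω i₀ j₀ ≠ C ω i₀ j₀) ≤
      uniformProb (fun ω => (1 / 4 - ε) * (Fintype.card F : ℝ) ^ 2 <
        ((Finset.univ.filter fun s : F × F => R ω s.1 s.2 ≠ C ω s.1 s.2).card : ℝ)) +
      (uniformProb (fun ω => 1 / 8 * (Fintype.card F : ℝ) <
        ((Finset.univ.filter fun j => C ω i₀ j ≠ φ ω j).card : ℝ)) +
      uniformProb (fun ω => 1 / 8 * (Fintype.card F : ℝ) <
        ((Finset.univ.filter fun i => R ω i j₀ ≠ ψ ω i).card : ℝ))) := by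
  refine (uniformProb_mono (q := fun ω => _ ∨ (_ ∨ _)) fun ω hne => ?_).trans
    ((uniformProb_or_le _ _).trans (add_le_add le_rfl (uniformProb_or_le _ _)))
  by_contra! hcon
  obtain ⟨h1, h2, h3⟩ := hcon
  refine hne (grid_row_eq_col (R ω) (C ω) d ε hε (hR ω) (hC ω) hd h1 i₀ j₀ (φ ω) (ψ ω)
    (hφ ω) ?_ (hψ ω) ?_)
  · have : (8 * (Finset.univ.filter fun j => C ω i₀ j ≠ φ ω j).card : ℝ) ≤ Fintype.card F := by
      linarith
    exact_mod_cast this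
  · have : (8 * (Finset.univ.filter fun i => R ω i j₀ ≠ ψ ω i).card : ℝ) ≤ Fintype.card F := by
      linarith
    exact_mod_cast this

open Classical in
/-- The indicator function of `0`. Where a probability is only controlled for nonzero
parameters, adding it to the bound accounts for the parameter `0`. -/
noncomputable def zeroIndicator {F : Type*} [Zero F] (i : F) : ℝ := if i = 0 then 1 else 0

theorem uniformProb_le_add_zeroIndicator {F Ω : Type*} [Zero F] [Fintype Ω]
    (p : Ω → Prop) (q : ℝ) (hq : 0 ≤ q) (i : F)
    (h : i ≠ 0 → uniformProb p ≤ q) : uniformProb p ≤ q + zeroIndicator i := by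
  by_cases hi : i = 0
  · rw [zeroIndicator, if_pos hi]; linarith [uniformProb_le_one p]
  · rw [zeroIndicator, if_neg hi]; linarith [h hi]

theorem sum_add_zeroIndicator (q : ℝ) :
    ∑ i : F, (q + zeroIndicator i) = q * Fintype.card F + 1 := by
  have h : ∑ i : F, zeroIndicator i = 1 := by
    rw [Finset.sum_eq_single 0 (fun i _ hi => by rw [zeroIndicator, if_neg hi]) (by simp),
      zeroIndicator, if_pos rfl]
  rw [Finset.sum_add_distrib, h, Finset.sum_const, Finset.card_univ, nsmul_eq_mul, mul_comm]

end Grid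

/-! ### The lines test for small errors -/

section Table

theorem IsUniformMap.uniformProb_eq_tableError {F V Ω : Type*} [Fintype V] [Fintype Ω]
    (L : Ω → V × V) (hL : IsUniformMap L) (W : V → V → F) (f : V → F) :
    uniformProb (fun ω => W (L ω).2 (L ω).1 ≠ f (L ω).1) = tableError W f :=
  hL.uniformProb_comp fun w : V × V => W w.2 w.1 ≠ f w.1

/-- A typical choice of the line through `a` predicts the value at `a` as well as two random
lines agree. -/
theorem exists_typical_value {F V : Type*} [Fintype V] [Nonempty V] (W : V → V → F) :
    ∃ g : V → F, ∀ a, uniformProb (fun b => W b a ≠ g a) ≤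
      uniformProb fun w : V × V => W w.2 a ≠ W w.1 a := by
  have : ∀ a, ∃ y : F, uniformProb (fun b => W b a ≠ y) ≤
      uniformProb fun w : V × V => W w.2 a ≠ W w.1 a := by
    intro a
    rw [uniformProb_prod_right]
    obtain ⟨c, hc⟩ := exists_le_mean fun c => uniformProb fun b => W c a ≠ W b a
    exact ⟨W c a, by simpa only [ne_comm] using hc⟩
  choose g hg using this
  exact ⟨g, hg⟩

variable {F V : Type*} [Field F] [AddCommGroup V] [Module F V]
variable {d : ℕ} {W : V → V → F} {f g : V → F}

theorem IsLineTable.comp_eq (hW : IsLineTable d W) (h x : V) (y : F → V)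
    (hy : ∀ t, y t = x + t • h) : IsLowDegree d fun t => W h (y t) := by
  simpa only [hy] using hW h x

variable [Fintype F]

theorem IsOptimalTable.comp_eq (hW : IsOptimalTable d W f) (h x : V) (y : F → V)
    (hy : ∀ t, y t = x + t • h) : IsBestFit d (fun t => W h (y t)) fun t => f (y t) := by
  simpa only [hy] using hW h x

variable [Fintype V]

/-- In the plane spanned by two random lines through a fixed point `a`, the line in the direction
`c` and the parallel to the other line through its point `a + j₀ • c` almost always predict the
same value there. For `j₀ = 0` this compares two random lines through `a`. -/
theorem IsOptimalTable.uniformProb_ne_le (hW : IsOptimalTable d W f)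
    (hd : 8 * d < Fintype.card F) (a : V) (j₀ : F) :
    uniformProb (fun w : V × V => W w.2 (a + j₀ • w.2) ≠ W w.1 (a + j₀ • w.2)) ≤
      32 * tableError W f + 32 / Fintype.card F := by
  classical
  set α := tableError W f with hα
  have hα0 : 0 ≤ α := uniformProb_nonneg _
  set n : ℝ := (Fintype.card F : ℝ) with hn
  have hn0 : 0 < n := by rw [hn]; exact_mod_cast Fintype.card_pos
  let p : V × V → F → F → V := fun w i j => a + i • w.1 + j • w.2
  have hrow : ∀ i j : F, i ≠ 0 →
      uniformProb (fun w => W w.2 (p w i j) ≠ f (p w i j)) ≤ α := fun i j hi =>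
    (IsUniformMap.uniformProb_eq_tableError _ (isUniformMap_plane_snd a hi j) W f).le
  have hcol : ∀ i j : F, j ≠ 0 →
      uniformProb (fun w => W w.1 (p w i j) ≠ f (p w i j)) ≤ α := fun i j hj =>
    (IsUniformMap.uniformProb_eq_tableError _ (isUniformMap_plane_fst a i hj) W f).le
  have hmain := uniformProb_row_ne_col_le (fun w i j => W w.2 (p w i j))
    (fun w i j => W w.1 (p w i j)) d (1 / 8) (by norm_num)
    (fun w i => hW.isLineTable.comp_eq _ (a + i • w.1) _ fun j => rfl)
    (fun w j => hW.isLineTable.comp_eq _ (a + j • w.2) _ fun i => add_right_comm _ _ _)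
    (by
      have : (8 * d : ℝ) < n := by rw [hn]; exact_mod_cast hd
      linarith) 0 j₀ (fun w j => f (p w 0 j)) (fun w i => f (p w i j₀))
    (fun w => hW.comp_eq _ (a + (0 : F) • w.1) _ fun j => rfl)
    (fun w => hW.comp_eq _ (a + j₀ • w.2) _ fun i => add_right_comm _ _ _)
  have m1 := mul_uniformProb_lt_card_le
    (fun (s : F × F) w => W w.2 (p w s.1 s.2) ≠ W w.1 (p w s.1 s.2))
    (fun s => (α + zeroIndicator s.1) + (α + zeroIndicator s.2))
    (fun s => (uniformProb_le_add
      (q := fun w => W w.2 (p w s.1 s.2) ≠ f (p w s.1 s.2))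
      (r := fun w => W w.1 (p w s.1 s.2) ≠ f (p w s.1 s.2)) (fun w hw => by
        by_contra! hcon
        exact hw (hcon.1.trans hcon.2.symm))).trans
      (add_le_add (uniformProb_le_add_zeroIndicator _ _ hα0 _ (hrow s.1 s.2))
        (uniformProb_le_add_zeroIndicator _ _ hα0 _ (hcol s.1 s.2)))) ((1 / 4 - 1 / 8) * n ^ 2)
  have m2 := mul_uniformProb_lt_card_le
    (fun j w => W w.1 (p w 0 j) ≠ f (p w 0 j)) (fun j => α + zeroIndicator j)
    (fun j => uniformProb_le_add_zeroIndicator _ _ hα0 _ (hcol 0 j)) (1 / 8 * n)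
  have m3 := mul_uniformProb_lt_card_le
    (fun i w => W w.2 (p w i j₀) ≠ f (p w i j₀)) (fun i => α + zeroIndicator i)
    (fun i => uniformProb_le_add_zeroIndicator _ _ hα0 _ fun hi => hrow i j₀ hi) (1 / 8 * n)
  rw [Finset.sum_add_distrib, Fintype.sum_prod_type, Fintype.sum_prod_type_right] at m1
  simp only [Finset.sum_const, Finset.card_univ, nsmul_eq_mul, ← Finset.mul_sum,
    sum_add_zeroIndicator, ← hn] at m1
  rw [sum_add_zeroIndicator, ← hn] at m2 m3
  have e1 : ∀ {x : ℝ}, (1 / 4 - 1 / 8) * n ^ 2 * x ≤ n * (α * n + 1) + n * (α * n + 1) →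
      x ≤ 16 * α + 16 / n := by
    intro x hx
    have : n ^ 2 * x ≤ n ^ 2 * (16 * α + 16 / n) := by
      have : n ^ 2 * (16 * α + 16 / n) = 8 * (n * (α * n + 1) + n * (α * n + 1)) := by
        field_simp; ring
      linarith
    exact le_of_mul_le_mul_left this (by positivity)
  have e2 : ∀ {x : ℝ}, 1 / 8 * n * x ≤ α * n + 1 → x ≤ 8 * α + 8 / n := by
    intro x hx
    have : n * x ≤ n * (8 * α + 8 / n) := by
      have : n * (8 * α + 8 / n) = 8 * (α * n + 1) := by field_simp
      linarith
    exact le_of_mul_le_mul_left this hn0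
  have hsum : 32 * α + 32 / n =
      (16 * α + 16 / n) + ((8 * α + 8 / n) + (8 * α + 8 / n)) := by ring
  rw [hsum]
  simp only [p, zero_smul, add_zero] at hmain m1 m2 m3
  exact hmain.trans (add_le_add (e1 m1) (add_le_add (e2 m2) (e2 m3)))

/-- If random lines through every point predict `g` there, and predict `f` elsewhere, then `g`
has low degree on every line: compare `g` on the given line with the values predicted by random
lines through its points, arranged as the rows of a grid. -/
theorem IsOptimalTable.isLowDegree_line (hW : IsOptimalTable d W f)
    (hd : 8 * d < Fintype.card F) (β : ℝ) (hβ0 : 0 ≤ β)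
    (hg : ∀ a, uniformProb (fun b => W b a ≠ g a) ≤ β)
    (hf : ∀ a, ∀ j : F, j ≠ 0 → uniformProb (fun c => W c (a + j • c) ≠ f (a + j • c)) ≤
      tableError W f + β)
    (hsmall : 24 * tableError W f + 17 * β + 16 / Fintype.card F < 1) (h a : V) :
    IsLowDegree d fun t => g (a + t • h) := by
  classical
  set α := tableError W f with hα
  have hα0 : 0 ≤ α := uniformProb_nonneg _
  set n : ℝ := (Fintype.card F : ℝ) with hn
  have hn0 : 0 < n := by rw [hn]; exact_mod_cast Fintype.card_pos
  obtain ⟨u, hu⟩ := exists_isBestFit d fun t : F => g (a + t • h)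
  suffices H : ∀ i₀, g (a + i₀ • h) = u i₀ by
    simpa only [H] using hu.1
  intro i₀
  let p : V × V → F → F → V := fun w i j => a + i • h + j • (w.1 + i • w.2)
  let R : V × V → F → F → F := fun w i j => W (w.1 + i • w.2) (p w i j)
  -- The column `0` is the given line; it carries the best fit of `g` instead of the table.
  let C : V × V → F → F → F := fun w i j => if j = 0 then u i else W (h + j • w.2) (p w i j)
  have hp0 : ∀ w i, p w i 0 = a + i • h := fun w i => by simp [p]
  have hpc : ∀ w i j, p w i j = a + j • w.1 + i • (h + j • w.2) := fun w i j => by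
    simp only [p]; module
  have hRf : ∀ i j, j ≠ 0 → uniformProb (fun w => R w i j ≠ f (p w i j)) ≤ α + β := by
    intro i j hj
    exact ((isUniformMap_add_smul i).uniformProb_comp fun c : V =>
      W c (a + i • h + j • c) ≠ f (a + i • h + j • c)).le.trans (hf _ j hj)
  have hRg : ∀ i, uniformProb (fun w => R w i 0 ≠ g (a + i • h)) ≤ β := by
    intro i
    simp only [R, hp0]
    exact ((isUniformMap_add_smul i).uniformProb_comp fun c : V =>
      W c (a + i • h) ≠ g (a + i • h)).le.trans (hg _)
  have hCf : ∀ i j, j ≠ 0 → uniformProb (fun w => C w i j ≠ f (p w i j)) ≤ α := by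
    intro i j hj
    simp only [C, if_neg hj]
    exact (IsUniformMap.uniformProb_eq_tableError _ (isUniformMap_column a h i hj) W f).le
  have hmain := uniformProb_row_ne_col_le R C d (1 / 8) (by norm_num)
    (fun w i => hW.isLineTable.comp_eq _ (a + i • h) _ fun j => rfl)
    (fun w j => by
      by_cases hj : j = 0
      · simpa only [C, if_pos hj] using hu.1
      · simpa only [C, if_neg hj] using
          hW.isLineTable.comp_eq (h + j • w.2) (a + j • w.1) _ fun i => hpc w i j)
    (by
      have : (8 * d : ℝ) < n := by rw [hn]; exact_mod_cast hd
      linarith) i₀ 0 (fun w j => f (p w i₀ j)) (fun w i => g (a + i • h))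
    (fun w => hW.comp_eq _ (a + i₀ • h) _ fun j => rfl)
    (fun w => by simpa only [C, if_true] using hu)
  have m1 := mul_uniformProb_lt_card_le (fun (s : F × F) w => R w s.1 s.2 ≠ C w s.1 s.2)
    (fun s => 2 * α + β + zeroIndicator s.2)
    (fun s => uniformProb_le_add_zeroIndicator _ _ (by positivity) _ fun hs => by
      refine (uniformProb_le_add (q := fun w => R w s.1 s.2 ≠ f (p w s.1 s.2))
        (r := fun w => C w s.1 s.2 ≠ f (p w s.1 s.2)) (fun w hw => by
          by_contra! hcon
          exact hw (hcon.1.trans hcon.2.symm))).trans ?_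
      have := hRf s.1 s.2 hs
      have := hCf s.1 s.2 hs
      linarith) ((1 / 4 - 1 / 8) * n ^ 2)
  have m2 := mul_uniformProb_lt_card_le (fun j w => C w i₀ j ≠ f (p w i₀ j))
    (fun j => α + zeroIndicator j)
    (fun j => uniformProb_le_add_zeroIndicator _ _ hα0 _ (hCf i₀ j)) (1 / 8 * n)
  have m3 := mul_uniformProb_lt_card_le (fun i w => R w i 0 ≠ g (a + i • h))
    (fun _ => β) hRg (1 / 8 * n)
  rw [Fintype.sum_prod_type] at m1
  simp only [sum_add_zeroIndicator, Finset.sum_const, Finset.card_univ, nsmul_eq_mul,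
    ← hn] at m1 m2 m3
  have e1 : ∀ {x : ℝ}, (1 / 4 - 1 / 8) * n ^ 2 * x ≤ n * ((2 * α + β) * n + 1) →
      x ≤ 8 * (2 * α + β) + 8 / n := by
    intro x hx
    have : n ^ 2 * x ≤ n ^ 2 * (8 * (2 * α + β) + 8 / n) := by
      have : n ^ 2 * (8 * (2 * α + β) + 8 / n) = 8 * (n * ((2 * α + β) * n + 1)) := by
        field_simp
      linarith
    exact le_of_mul_le_mul_left this (by positivity)
  have e2 : ∀ {x : ℝ}, 1 / 8 * n * x ≤ α * n + 1 → x ≤ 8 * α + 8 / n := by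
    intro x hx
    have : n * x ≤ n * (8 * α + 8 / n) := by
      have : n * (8 * α + 8 / n) = 8 * (α * n + 1) := by field_simp
      linarith
    exact le_of_mul_le_mul_left this hn0
  have e3 : ∀ {x : ℝ}, 1 / 8 * n * x ≤ n * β → x ≤ 8 * β := by
    intro x hx
    have : n * x ≤ n * (8 * β) := by linarith
    exact le_of_mul_le_mul_left this hn0
  have hne : uniformProb (fun w => R w i₀ 0 ≠ C w i₀ 0 ∨ R w i₀ 0 ≠ g (a + i₀ • h)) < 1 := by
    refine (uniformProb_or_le _ _).trans_lt ?_
    have h1 := hmain.trans (add_le_add (e1 m1) (add_le_add (e2 m2) (e3 m3)))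
    have h2 := hRg i₀
    have h3 : 8 / n + 8 / n = 16 / n := by ring
    linarith
  obtain ⟨w, hw⟩ := exists_not_of_uniformProb_lt_one _ hne
  push Not at hw
  rw [← hw.2, hw.1]
  simp only [C, if_true]

/-- The lines test for a small absolute rejection probability: the function predicted by most
lines through each point has low degree on every line. -/
theorem IsOptimalTable.exists_lowDegree_of_small (hW : IsOptimalTable d W f)
    (hd : 8 * d < Fintype.card F) (hn : 2000 ≤ Fintype.card F)
    (hα : tableError W f ≤ 1 / 2000) :
    ∃ g : V → F, (∀ h x, IsLowDegree d fun t => g (x + t • h)) ∧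
      uniformProb (fun x => f x ≠ g x) ≤ 2 * tableError W f := by
  classical
  have hα0 : 0 ≤ tableError W f := uniformProb_nonneg _
  have hnr : (2000 : ℝ) ≤ Fintype.card F := by exact_mod_cast hn
  have hinv : 1 / (Fintype.card F : ℝ) ≤ 1 / 2000 :=
    one_div_le_one_div_of_le (by norm_num) hnr
  have hinv0 : 0 ≤ 1 / (Fintype.card F : ℝ) := by positivity
  set β := 32 * tableError W f + 32 / Fintype.card F with hβ
  have hβe : β = 32 * tableError W f + 32 * (1 / Fintype.card F) := by rw [hβ]; ring
  obtain ⟨g, hg⟩ := exists_typical_value W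
  have hgβ : ∀ a, uniformProb (fun b => W b a ≠ g a) ≤ β := by
    intro a
    refine (hg a).trans ?_
    simpa using hW.uniformProb_ne_le hd a 0
  refine ⟨g, ?_, ?_⟩
  · refine hW.isLowDegree_line hd β (by linarith) hgβ (fun a j hj => ?_) ?_
    -- Away from `a`, the prediction is compared with that of an independent line.
    · have h1 := (IsUniformMap.snd (α := V) (β := V)).uniformProb_comp
        fun c : V => W c (a + j • c) ≠ f (a + j • c)
      rw [← h1]
      refine (uniformProb_le_add (q := fun w : V × V => W w.1 (a + j • w.2) ≠ f (a + j • w.2))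
        (r := fun w : V × V => W w.2 (a + j • w.2) ≠ W w.1 (a + j • w.2)) fun w hw => ?_).trans
        (add_le_add ?_ (hW.uniformProb_ne_le hd a j))
      · by_contra! hcon
        exact hw (hcon.2.trans hcon.1)
      · have h2 := IsUniformMap.uniformProb_eq_tableError _ (isUniformMap_plane_fst a 0 hj) W f
        simp only [zero_smul, add_zero] at h2
        exact h2.le
    · have : 16 / (Fintype.card F : ℝ) = 16 * (1 / Fintype.card F) := by ring
      rw [this]
      linarith
  · rw [tableError, uniformProb_prod, ← mean_mul_left, uniformProb_eq_mean]
    refine mean_mono fun x => ?_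
    split_ifs with hx
    -- Every line is wrong about `f x` or about `g x`, and the latter happens for at most half.
    · have h1 : (1 : ℝ) = uniformProb fun _ : V => True := by
        rw [uniformProb_eq_mean]; simp [mean_const]
      have h2 := uniformProb_le_add (p := fun _ : V => True) (q := fun b => W b x ≠ f x)
        (r := fun b => W b x ≠ g x) fun b _ => by
          by_contra! hcon
          exact hx (hcon.1.symm.trans hcon.2)
      have h3 := hgβ x
      rw [← h1] at h2
      simp only
      linarith
    · exact mul_nonneg zero_le_two (uniformProb_nonneg _)

end Table

/-! ### The lines test below one eighth -/

section Boost

theorem uniformProb_ne_le_tableError_add {F V : Type*} [Fintype V] [Nonempty V]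
    (W : V → V → F) (f g : V → F) :
    uniformProb (fun x => f x ≠ g x) ≤ tableError W f + tableError W g := by
  rw [← (IsUniformMap.fst (α := V) (β := V)).uniformProb_comp]
  refine uniformProb_le_add fun w hw => ?_
  by_contra! hcon
  exact hw (hcon.1.symm.trans hcon.2)

variable {F V : Type*} [Field F] [Fintype F] [AddCommGroup V] [Module F V] [Fintype V]
variable {d : ℕ} {W : V → V → F} {f g : V → F}

/-- Two random lines through a random point almost always predict the same value there. In the
random bilinear grid `a + i • b + j • c + (i * j) • e` any two rows are independent uniform lines,
and so are any two columns, so by Chebyshev's inequality the errors of the rows and of the columns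
concentrate around their mean, which is below one eighth. -/
theorem IsOptimalTable.uniformProb_ne_le_of_lt_eighth (hW : IsOptimalTable d W f) (ε : ℝ)
    (hε : 0 < ε) (hd : (d : ℝ) < ε * Fintype.card F) (hα : tableError W f ≤ 1 / 8 - ε) :
    uniformProb (fun w : (V × V) × V × V => W w.2.1 w.1.1 ≠ W w.1.2 w.1.1) ≤
      16 / (ε ^ 2 * Fintype.card F) := by
  classical
  set α := tableError W f with hαdef
  set n : ℝ := (Fintype.card F : ℝ) with hn
  have hn0 : 0 < n := by rw [hn]; exact_mod_cast Fintype.card_pos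
  let L : F → (V × V) × V × V → V × V := fun i w =>
    (w.1.1 + i • w.1.2, w.2.1 + i • w.2.2)
  let σ : (V × V) × V × V → (V × V) × V × V := fun w => ((w.1.1, w.2.1), (w.1.2, w.2.2))
  have hσ : IsUniformMap σ := .of_injective fun v w h => by
    simp only [σ, Prod.mk.injEq] at h
    exact Prod.ext (Prod.ext h.1.1 h.2.1) (Prod.ext h.1.2 h.2.2)
  let p : (V × V) × V × V → F → F → V := fun w i j => (L i w).1 + j • (L i w).2
  have hp : ∀ w i j, p w i j = (L j (σ w)).1 + i • (L j (σ w)).2 := fun w i j => by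
    simp only [p, L, σ]; module
  -- The concentration of a line statistic `Φ` over the rows and over the columns.
  have conc : ∀ Φ : V × V → ℝ, (∀ w, 0 ≤ Φ w) → (∀ w, Φ w ≤ 1) → mean Φ = α →
      uniformProb (fun w => (α + ε / 2) * n < ∑ i, Φ (L i w)) ≤ 4 / (ε ^ 2 * n) ∧
      uniformProb (fun w => (α + ε / 2) * n < ∑ i, Φ (L i (σ w))) ≤ 4 / (ε ^ 2 * n) := by
    intro Φ h0 h1 hΦ
    have h2 := uniformProb_lt_sum_le L Φ h0 h1 isUniformMap_row (fun i k => isUniformMap_rows)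
      (ε / 2) (by positivity)
    rw [hΦ, ← hn] at h2
    have h3 : 1 / ((ε / 2) ^ 2 * n) = 4 / (ε ^ 2 * n) := by field_simp; norm_num
    rw [h3] at h2
    exact ⟨h2, (hσ.uniformProb_comp fun w => (α + ε / 2) * n < ∑ i, Φ (L i w)).le.trans h2⟩
  obtain ⟨c1, c2⟩ := conc
    (fun w => uniformProb fun t : F => W w.2 (w.1 + t • w.2) ≠ f (w.1 + t • w.2))
    (fun w => uniformProb_nonneg _) (fun w => uniformProb_le_one _)
    (mean_line_eq_tableError W f)
  obtain ⟨c3, c4⟩ := conc (fun w => if W w.2 w.1 ≠ f w.1 then 1 else 0)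
    (fun w => by positivity) (fun w => by split_ifs <;> norm_num)
    (by rw [hαdef, tableError, uniformProb_eq_mean]; congr!)
  have hmain := uniformProb_row_ne_col_le (fun w i j => W (L i w).2 (p w i j))
    (fun w i j => W (L j (σ w)).2 (p w i j)) d ε hε
    (fun w i => hW.isLineTable.comp_eq _ (L i w).1 _ fun j => rfl)
    (fun w j => hW.isLineTable.comp_eq _ (L j (σ w)).1 _ fun i => hp w i j)
    hd 0 0 (fun w j => f (p w 0 j)) (fun w i => f (p w i 0))
    (fun w => hW.comp_eq _ (L 0 w).1 _ fun j => rfl)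
    (fun w => hW.comp_eq _ (L 0 (σ w)).1 _ fun i => hp w i 0)
  have b1 : uniformProb (fun w => (1 / 4 - ε) * n ^ 2 <
      ((Finset.univ.filter fun s : F × F =>
        W (L s.1 w).2 (p w s.1 s.2) ≠ W (L s.2 (σ w)).2 (p w s.1 s.2)).card : ℝ)) ≤
      4 / (ε ^ 2 * n) + 4 / (ε ^ 2 * n) := by
    refine (uniformProb_le_add fun w hw => ?_).trans (add_le_add c1 c2)
    by_contra! hcon
    refine absurd hw (not_lt.mpr ?_)
    have h1 : ((Finset.univ.filter fun s : F × F =>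
        W (L s.1 w).2 (p w s.1 s.2) ≠ f (p w s.1 s.2)).card : ℝ) ≤ n * ((α + ε / 2) * n) := by
      refine le_trans (le_of_eq ?_) (mul_le_mul_of_nonneg_left hcon.1 hn0.le)
      rw [card_filter_prod_eq_sum fun i j => W (L i w).2 (p w i j) ≠ f (p w i j),
        Nat.cast_sum, Finset.mul_sum]
      refine Finset.sum_congr rfl fun i _ => ?_
      rw [uniformProb, ← hn, mul_div_cancel₀ _ hn0.ne']
      congr!
    have h2 : ((Finset.univ.filter fun s : F × F =>
        W (L s.2 (σ w)).2 (p w s.1 s.2) ≠ f (p w s.1 s.2)).card : ℝ) ≤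
        n * ((α + ε / 2) * n) := by
      refine le_trans (le_of_eq ?_) (mul_le_mul_of_nonneg_left hcon.2 hn0.le)
      rw [card_filter_prod_eq_sum_right fun i j => W (L j (σ w)).2 (p w i j) ≠ f (p w i j),
        Nat.cast_sum, Finset.mul_sum]
      refine Finset.sum_congr rfl fun j _ => ?_
      rw [uniformProb, ← hn, mul_div_cancel₀ _ hn0.ne']
      simp only [hp]
      congr!
    have h3 : ((Finset.univ.filter fun s : F × F =>
        W (L s.1 w).2 (p w s.1 s.2) ≠ W (L s.2 (σ w)).2 (p w s.1 s.2)).card : ℝ) ≤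
        (Finset.univ.filter fun s : F × F =>
          W (L s.1 w).2 (p w s.1 s.2) ≠ f (p w s.1 s.2)).card +
        (Finset.univ.filter fun s : F × F =>
          W (L s.2 (σ w)).2 (p w s.1 s.2) ≠ f (p w s.1 s.2)).card := by
      have h4 := (Finset.card_le_card (s := Finset.univ.filter fun s : F × F =>
        W (L s.1 w).2 (p w s.1 s.2) ≠ W (L s.2 (σ w)).2 (p w s.1 s.2))
        (t := (Finset.univ.filter fun s : F × F =>
          W (L s.1 w).2 (p w s.1 s.2) ≠ f (p w s.1 s.2)) ∪
        (Finset.univ.filter fun s : F × F =>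
          W (L s.2 (σ w)).2 (p w s.1 s.2) ≠ f (p w s.1 s.2))) fun s hs => by
            simp only [Finset.mem_union, Finset.mem_filter, Finset.mem_univ, true_and] at hs ⊢
            by_contra! hcon
            exact hs (hcon.1.trans hcon.2.symm)).trans (Finset.card_union_le _ _)
      exact_mod_cast h4
    have h5 : (α + ε / 2) * (n * n) ≤ (1 / 8 - ε / 2) * (n * n) :=
      mul_le_mul_of_nonneg_right (by linarith) (by positivity)
    nlinarith
  have b2 : uniformProb (fun w => 1 / 8 * n <
      ((Finset.univ.filter fun j => W (L j (σ w)).2 (p w 0 j) ≠ f (p w 0 j)).card : ℝ)) ≤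
      4 / (ε ^ 2 * n) := by
    refine (uniformProb_mono fun w hw => ?_).trans c4
    rw [Finset.sum_boole]
    simp only [hp, zero_smul, add_zero] at hw
    refine lt_of_le_of_lt ?_ hw
    exact mul_le_mul_of_nonneg_right (by linarith) hn0.le
  have b3 : uniformProb (fun w => 1 / 8 * n <
      ((Finset.univ.filter fun i => W (L i w).2 (p w i 0) ≠ f (p w i 0)).card : ℝ)) ≤
      4 / (ε ^ 2 * n) := by
    refine (uniformProb_mono fun w hw => ?_).trans c3
    rw [Finset.sum_boole]
    simp only [p, zero_smul, add_zero] at hw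
    refine lt_of_le_of_lt ?_ hw
    exact mul_le_mul_of_nonneg_right (by linarith) hn0.le
  have hfin := hmain.trans (add_le_add b1 (add_le_add b2 b3))
  simp only [p, L, σ, zero_smul, add_zero] at hfin
  refine hfin.trans (le_of_eq ?_)
  ring

/-- Below the threshold `1 / 8`, the table `W` is almost always right for a suitable function
`g`, although `f` itself may disagree with it on a constant fraction of the points. -/
theorem IsOptimalTable.exists_tableError_le (hW : IsOptimalTable d W f) (ε : ℝ)
    (hε : 0 < ε) (hd : (d : ℝ) < ε * Fintype.card F) (hα : tableError W f ≤ 1 / 8 - ε) :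
    ∃ g : V → F, tableError W g ≤ 16 / (ε ^ 2 * Fintype.card F) := by
  obtain ⟨g, hg⟩ := exists_typical_value W
  refine ⟨g, le_trans ?_ (hW.uniformProb_ne_le_of_lt_eighth ε hε hd hα)⟩
  let τ : (V × V) × V × V → (V × V × V) × V := fun w => ((w.1.1, w.1.2, w.2.1), w.2.2)
  have hτ : IsUniformMap τ := .of_bijective
    ⟨fun v w h => by
      simp only [τ, Prod.mk.injEq] at h
      exact Prod.ext (Prod.ext h.1.1 h.1.2.1) (Prod.ext h.1.2.2 h.2),
    fun v => ⟨((v.1.1, v.1.2.1), (v.1.2.2, v.2)), rfl⟩⟩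
  have h1 := (IsUniformMap.fst.comp hτ).uniformProb_comp
    fun v : V × V × V => W v.2.2 v.1 ≠ W v.2.1 v.1
  simp only [τ] at h1
  rw [h1, tableError, uniformProb_prod, uniformProb_prod]
  exact mean_mono hg

/-- The lines test below the threshold `1 / 8`, on an arbitrary finite vector space. If the error
is not yet small, the test for small errors is applied to the corrected function `g`. -/
theorem exists_lowDegree_of_lt_eighth (hW : IsOptimalTable d W f) (ε : ℝ) (hε : 0 < ε)
    (hd : (d : ℝ) < ε * Fintype.card F) (hα : tableError W f ≤ 1 / 8 - ε)
    (hn : 2000 ≤ Fintype.card F) (hnε : 96000 ≤ ε ^ 2 * Fintype.card F) :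
    ∃ q : V → F, (∀ h x, IsLowDegree d fun t => q (x + t • h)) ∧
      uniformProb (fun x => f x ≠ q x) ≤ 2 * tableError W f := by
  have hα0 : 0 ≤ tableError W f := uniformProb_nonneg _
  have hd8 : 8 * d < Fintype.card F := by
    have hn0 : (0 : ℝ) < Fintype.card F := by exact_mod_cast Fintype.card_pos
    have : (8 * d : ℝ) < Fintype.card F := by nlinarith
    exact_mod_cast this
  rcases le_or_gt (tableError W f) (1 / 2000) with hsmall | hlarge
  · exact hW.exists_lowDegree_of_small hd8 hn hsmall
  obtain ⟨g, hg⟩ := hW.exists_tableError_le ε hε hd hα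
  -- With `γ ≤ 1 / 6000`, the loss `3 * γ` is at most the error, which exceeds `1 / 2000`.
  have hγ : 16 / (ε ^ 2 * Fintype.card F) ≤ 1 / 6000 := by
    rw [div_le_div_iff₀ (by linarith) (by norm_num)]; linarith
  obtain ⟨W', hW'⟩ := exists_isOptimalTable d g
  have h1 : tableError W' g ≤ tableError W g := by
    refine (hW'.tableError_le (fun x h t => W h (x + t • h))
      fun x h => hW.isLineTable h x).trans (le_of_eq ?_)
    exact mean_line_eq_tableError W g
  obtain ⟨q, hq, hqg⟩ := hW'.exists_lowDegree_of_small hd8 hn (by linarith)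
  refine ⟨q, hq, ?_⟩
  have h2 := uniformProb_ne_le_tableError_add W f g
  have h3 := uniformProb_le_add (p := fun x => f x ≠ q x) (q := fun x => f x ≠ g x)
    (r := fun x => g x ≠ q x) fun x hx => by
      by_contra! hcon
      exact hx (hcon.1.trans hcon.2)
  linarith

end Boost

end LowDegreeTest

theorem mainTheorem1 (ε : ℝ) (hε : 0 < ε) :
    ∃ c : ℝ, ∀ d : ℕ, 0 < d →
      ∀ (F : Type*) [Field F] [Fintype F], c * (d : ℝ) ≤ (Fintype.card F : ℝ) →
        ∀ (m : ℕ) (f : (Fin m → F) → F)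
          (P : (Fin m → F) → (Fin m → F) → Polynomial F),
          (∀ x h : Fin m → F, (P x h).natDegree ≤ d) →
          ∀ δ : ℝ, LowDegreeTest.rejectProb f P = δ → δ ≤ 1 / 8 - ε →
            ∃ g : MvPolynomial (Fin m) F, g.totalDegree ≤ d ∧
              LowDegreeTest.dist f (fun x => MvPolynomial.eval x g) ≤ 2 * δ := by
  -- The summands provide `96000 ≤ ε ^ 2 * |F|`, `d < ε * |F|` and `2000 ≤ |F|`.
  refine ⟨96000 / ε ^ 2 + 2 / ε + 2000, ?_⟩
  intro d hd F _ _ hc m f P hP δ hδ hδε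
  have hd1 : (1 : ℝ) ≤ d := by exact_mod_cast hd
  have t1 : 0 < 96000 / ε ^ 2 := by positivity
  have t2 : 0 < 2 / ε := by positivity
  have hcd : ∀ c' : ℝ, 0 ≤ c' → c' ≤ 96000 / ε ^ 2 + 2 / ε + 2000 →
      c' * d ≤ Fintype.card F := fun c' _ h =>
    (mul_le_mul_of_nonneg_right h (by linarith)).trans hc
  have hc1 : ∀ c' : ℝ, 0 ≤ c' → c' ≤ 96000 / ε ^ 2 + 2 / ε + 2000 →
      c' ≤ Fintype.card F := fun c' h0 h =>
    (le_mul_of_one_le_right h0 hd1).trans (hcd c' h0 h)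
  have hn : 2000 ≤ Fintype.card F := by
    exact_mod_cast hc1 2000 (by norm_num) (by linarith)
  have hnε : 96000 ≤ ε ^ 2 * Fintype.card F := by
    have := hc1 (96000 / ε ^ 2) t1.le (by linarith)
    rwa [div_le_iff₀' (by positivity)] at this
  have hdε : (d : ℝ) < ε * Fintype.card F := by
    have h1 := hcd (2 / ε) t2.le (by linarith)
    have h2 : 2 * (d : ℝ) ≤ ε * Fintype.card F := by
      rw [div_mul_eq_mul_div, div_le_iff₀' hε] at h1
      exact h1
    linarith
  have hd2 : 2 * d < Fintype.card F := by
    have h1 := hcd 2000 (by norm_num) (by linarith)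
    have h2 : (2 * d : ℝ) < Fintype.card F := by linarith
    exact_mod_cast h2
  obtain ⟨W, hW⟩ := LowDegreeTest.exists_isOptimalTable d f
  have hWδ : LowDegreeTest.tableError W f ≤ δ := by
    refine (hW.tableError_le (fun x h t => (P x h).eval t)
      fun x h => ⟨P x h, hP x h, fun _ => rfl⟩).trans (le_of_eq ?_)
    rw [← hδ, LowDegreeTest.rejectProb, LowDegreeTest.uniformProb_prod, LowDegreeTest.mean_prod]
    simp only [LowDegreeTest.uniformProb_prod]
  obtain ⟨q, hq, hqf⟩ := LowDegreeTest.exists_lowDegree_of_lt_eighth hW ε hε hdε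
    (hWδ.trans hδε) hn hnε
  obtain ⟨G, hG, hGq⟩ := LowDegreeTest.exists_mvPolynomial_of_forall_line hd2 m q hq
  refine ⟨G, hG, ?_⟩
  simp only [LowDegreeTest.dist, hGq]
  linarith
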